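/- For a finite subset $A$ of an abelian group, let $E(A)=\#\{(a_1,a_2,a_3,a_4)\in A^4: a_1+a_2=a_3+a_4\}$ be its additive energy. For every integer $n\ge 2$ there is a smallest real number $t_n$ such that $E(A)\le |A|^{t_n}$ for all positive integers $d$ and all subsets $A\subset\{0,1,\dots,n-1\}^d\subset\mathbb{Z}^d$. Moreover, there are an absolute constant $c>0$ and a sequence $(\varepsilon_n)_{n\ge 2}$ of real numbers with $\varepsilon_n\to 0$ as $n\to\infty$ such that, for every integer $n\ge 2$, $$3-(1+\varepsilon_n)\log_n\frac{3\sqrt3}{4}\;\le\; t_n\;\le\; 3-\log_n(1+c).$$ -/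

import Mathlib

open Filter Topology

/-- The discrete cube `{0, 1, …, n - 1}ᵈ`, as a finite subset of `ℤᵈ`. -/
noncomputable def discreteCube (n d : ℕ) : Finset (Fin d → ℤ) :=
  Fintype.piFinset fun _ => Finset.Ico (0 : ℤ) (n : ℤ)

/-- The exponents `t` such that `E(A) ≤ |A| ^ t` for all positive integers `d` and all subsets
`A` of `{0, 1, …, n - 1}ᵈ`. Here `Finset.addEnergy A A` is the number of quadruples in `A ^ 4`
with `a₁ + b₁ = a₂ + b₂`. -/
def energyExponents (n : ℕ) : Set ℝ :=
  {t : ℝ | ∀ d : ℕ, 0 < d → ∀ A : Finset (Fin d → ℤ), A ⊆ discreteCube n d →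
    (Finset.addEnergy A A : ℝ) ≤ (A.card : ℝ) ^ t}

/-- The number `t_n`: the smallest of the exponents in `energyExponents n`
(that the infimum is attained is part of what the theorem asserts). -/
noncomputable def minEnergyExponent (n : ℕ) : ℝ :=
  sInf (energyExponents n)

/-! For `f ≥ 0` write `E(f)` for the additive energy. A real `t > 0` is admissible for all subsets
of all cubes exactly when `E(f) ≤ ‖f‖_{4/t}^4` for every `f ≥ 0` on `{0, …, n-1}`. The functional
inequality tensorises, because the energy form obeys a four-fold Cauchy–Schwarz inequality
(`energyForm_le`), and indicators then give the bound for sets. Conversely, `f^{⊗d}` takes at most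
`(d+1)^n` values, so the bound for sets controls it up to a factor polynomial in `d`, which
disappears on taking `d`-th roots (`energyOf_le_of_mem_energyExponents`).

Upper bound. For `t = 3` the inequality is Young's, with equality at point masses. Hölder passes
from `t = 3` to a smaller `t` at the price `n^(3-t)`, which equals `1 + c` when `t = 3 -
log_n(1+c)`. So a gain by a constant factor in Young's inequality suffices. Put `f = u^3` with `∑
u^4 = 1`. Then `E(f)` is at most the mean, over independent `X, Y` distributed as `u^4`, of the
Bhattacharyya correlation of this distribution with its translate by `X - Y`. That correlation is
bounded away from 1 once the interval between `X` and `Y` carries mass, which happens often enough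
unless `u^4` is nearly a point mass (`energyOf_cube_le_of_not_concentrated`). Near a point mass
there is no gain to spend, and a direct perturbation argument gives the inequality
(`energyOf_cube_le_of_concentrated`).

Lower bound. A discretised Gaussian of width `n / log n` is tested in the functional inequality.
With `W` its mass `‖f‖_{4/3}^{4/3}`, the ratio `W^3 / E(f)` tends to its value `3√3/4` for Gaussians
on the line, while `log W` is asymptotic to `log n`. -/

/-! ### Energy as a quadrilinear form and its Cauchy–Schwarz inequalities. -/

section EnergyForm

variable {ι κ : Type*} [DecidableEq κ]

lemma sum_fiber_mul_fiber (I : Finset ι) (φ : ι → κ) (w v : ι → ℝ) :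
    ∑ p ∈ I ×ˢ I with φ p.1 = φ p.2, w p.1 * v p.2 =
      ∑ s ∈ I.image φ, (∑ i ∈ I with φ i = s, w i) * ∑ i ∈ I with φ i = s, v i := by
  classical
  rw [← Finset.sum_fiberwise_of_maps_to (s := {p ∈ I ×ˢ I | φ p.1 = φ p.2})
    (t := I.image φ) (g := fun p => φ p.1)]
  · refine Finset.sum_congr rfl fun s _ => ?_
    rw [Finset.sum_mul_sum, ← Finset.sum_product']
    refine Finset.sum_congr ?_ fun _ _ => rfl
    ext ⟨a, b⟩
    simp only [Finset.mem_filter, Finset.mem_product]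
    constructor
    · rintro ⟨⟨⟨ha, hb⟩, h⟩, rfl⟩; exact ⟨⟨ha, rfl⟩, hb, h.symm⟩
    · rintro ⟨⟨ha, rfl⟩, hb, h⟩; exact ⟨⟨⟨ha, hb⟩, h.symm⟩, rfl⟩
  · intro p hp
    simp only [Finset.mem_filter, Finset.mem_product] at hp
    exact Finset.mem_image_of_mem _ hp.1.1

lemma sum_fiber_mul_fiber_sq_le (I : Finset ι) (φ : ι → κ) (w v : ι → ℝ) :
    (∑ p ∈ I ×ˢ I with φ p.1 = φ p.2, w p.1 * v p.2) ^ 2 ≤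
      (∑ p ∈ I ×ˢ I with φ p.1 = φ p.2, w p.1 * w p.2) *
        ∑ p ∈ I ×ˢ I with φ p.1 = φ p.2, v p.1 * v p.2 := by
  simp only [sum_fiber_mul_fiber, ← sq]
  exact Finset.sum_mul_sq_le_sq_mul_sq _ _ _

variable {G : Type*} [AddCommGroup G] [DecidableEq G]

/-- The quadrilinear form `∑ f₁(a) f₂(b) f₃(c) f₄(d)` over `a + b = c + d` in `T`. -/
noncomputable def energyForm (T : Finset G) (f₁ f₂ f₃ f₄ : G → ℝ) : ℝ :=
  ∑ p ∈ (T ×ˢ T) ×ˢ (T ×ˢ T) with p.1.1 + p.1.2 = p.2.1 + p.2.2,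
    (f₁ p.1.1 * f₂ p.1.2) * (f₃ p.2.1 * f₄ p.2.2)

/-- The additive energy of a function on `T`. -/
noncomputable def energyOf (T : Finset G) (f : G → ℝ) : ℝ := energyForm T f f f f

lemma energyForm_congr {T : Finset G} {f₁ f₂ f₃ f₄ g₁ g₂ g₃ g₄ : G → ℝ}
    (h₁ : ∀ x ∈ T, f₁ x = g₁ x) (h₂ : ∀ x ∈ T, f₂ x = g₂ x) (h₃ : ∀ x ∈ T, f₃ x = g₃ x)
    (h₄ : ∀ x ∈ T, f₄ x = g₄ x) :
    energyForm T f₁ f₂ f₃ f₄ = energyForm T g₁ g₂ g₃ g₄ := by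
  refine Finset.sum_congr rfl fun p hp => ?_
  simp only [Finset.mem_filter, Finset.mem_product] at hp
  rw [h₁ _ hp.1.1.1, h₂ _ hp.1.1.2, h₃ _ hp.1.2.1, h₄ _ hp.1.2.2]

/-- The equation `a + b = c + d` is also `a - c = d - b`. This regrouping pairs `f` with `h`,
allowing a second, different use of Cauchy–Schwarz and showing that energies are sums of squares. -/
lemma energyForm_eq_sub (T : Finset G) (f g h k : G → ℝ) :
    energyForm T f g h k =
      ∑ p ∈ (T ×ˢ T) ×ˢ (T ×ˢ T) with p.1.1 - p.1.2 = p.2.1 - p.2.2,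
        (f p.1.1 * h p.1.2) * (k p.2.1 * g p.2.2) := by
  refine Finset.sum_nbij' (fun p => ((p.1.1, p.2.1), (p.2.2, p.1.2)))
    (fun p => ((p.1.1, p.2.2), (p.1.2, p.2.1))) ?_ ?_ ?_ ?_ ?_
  · rintro ⟨⟨a, b⟩, c, d⟩ hp
    simp only [Finset.mem_filter, Finset.mem_product] at hp ⊢
    refine ⟨by tauto, ?_⟩
    rw [sub_eq_sub_iff_add_eq_add, hp.2, add_comm]
  · rintro ⟨⟨a, b⟩, c, d⟩ hp
    simp only [Finset.mem_filter, Finset.mem_product] at hp ⊢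
    refine ⟨by tauto, ?_⟩
    rw [sub_eq_sub_iff_add_eq_add.1 hp.2, add_comm]
  · simp
  · simp
  · rintro ⟨⟨a, b⟩, c, d⟩ -
    ring

lemma energyForm_eq_sum_diff (T : Finset G) (f g h k : G → ℝ) :
    energyForm T f g h k = ∑ s ∈ (T ×ˢ T).image (fun p => p.1 - p.2),
      (∑ p ∈ T ×ˢ T with p.1 - p.2 = s, f p.1 * h p.2) *
        ∑ p ∈ T ×ˢ T with p.1 - p.2 = s, k p.1 * g p.2 := by
  rw [energyForm_eq_sub]
  exact sum_fiber_mul_fiber (T ×ˢ T) (fun p : G × G => p.1 - p.2) (fun p => f p.1 * h p.2)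
    (fun p => k p.1 * g p.2)

lemma energyOf_eq_sum_sq (T : Finset G) (f : G → ℝ) :
    energyOf T f = ∑ s ∈ (T ×ˢ T).image (fun p => p.1 - p.2),
      (∑ p ∈ T ×ˢ T with p.1 - p.2 = s, f p.1 * f p.2) ^ 2 := by
  simp only [energyOf, energyForm_eq_sum_diff, sq]

lemma energyOf_nonneg (T : Finset G) (f : G → ℝ) : 0 ≤ energyOf T f := by
  rw [energyOf_eq_sum_sq]; positivity

lemma energyForm_sq_le (T : Finset G) (f g h k : G → ℝ) :
    energyForm T f g h k ^ 2 ≤ energyForm T f g f g * energyForm T h k h k :=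
  sum_fiber_mul_fiber_sq_le (T ×ˢ T) (fun p : G × G => p.1 + p.2) (fun p => f p.1 * g p.2)
    (fun p => h p.1 * k p.2)

lemma energyForm_self_sq_le (T : Finset G) (f g : G → ℝ) :
    energyForm T f g f g ^ 2 ≤ energyOf T f * energyOf T g := by
  simp only [energyOf, energyForm_eq_sub]
  exact sum_fiber_mul_fiber_sq_le (T ×ˢ T) (fun p : G × G => p.1 - p.2)
    (fun p => f p.1 * f p.2) (fun p => g p.1 * g p.2)

/-- Cauchy–Schwarz over the common sum separates `(f, g)` from `(h, k)`; Cauchy–Schwarz over the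
common difference then separates the two members of each pair. -/
lemma energyForm_pow_four_le (T : Finset G) (f g h k : G → ℝ) :
    energyForm T f g h k ^ 4 ≤ energyOf T f * energyOf T g * (energyOf T h * energyOf T k) := by
  calc energyForm T f g h k ^ 4 = (energyForm T f g h k ^ 2) ^ 2 := by ring
    _ ≤ (energyForm T f g f g * energyForm T h k h k) ^ 2 :=
        pow_le_pow_left₀ (sq_nonneg _) (energyForm_sq_le T f g h k) 2
    _ = energyForm T f g f g ^ 2 * energyForm T h k h k ^ 2 := by ring
    _ ≤ _ := mul_le_mul (energyForm_self_sq_le T f g) (energyForm_self_sq_le T h k)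
        (sq_nonneg _) (mul_nonneg (energyOf_nonneg _ _) (energyOf_nonneg _ _))

lemma energyForm_le (T : Finset G) (f g h k : G → ℝ) :
    energyForm T f g h k ≤ (energyOf T f ^ (1 / 4 : ℝ) * energyOf T g ^ (1 / 4 : ℝ)) *
      (energyOf T h ^ (1 / 4 : ℝ) * energyOf T k ^ (1 / 4 : ℝ)) := by
  have hr : ∀ f : G → ℝ, (energyOf T f ^ (1 / 4 : ℝ)) ^ 4 = energyOf T f := fun f => by
    rw [← Real.rpow_natCast, ← Real.rpow_mul (energyOf_nonneg T f)]; norm_num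
  have hp : ∀ f : G → ℝ, 0 ≤ energyOf T f ^ (1 / 4 : ℝ) := fun f =>
    Real.rpow_nonneg (energyOf_nonneg T f) _
  refine le_of_pow_le_pow_left₀ (n := 4) (by norm_num)
    (mul_nonneg (mul_nonneg (hp f) (hp g)) (mul_nonneg (hp h) (hp k))) ?_
  rw [mul_pow, mul_pow, mul_pow, hr, hr, hr, hr]
  exact energyForm_pow_four_le T f g h k

lemma energyOf_smul (T : Finset G) (c : ℝ) (f : G → ℝ) :
    energyOf T (fun x => c * f x) = c ^ 4 * energyOf T f := by
  simp only [energyOf, energyForm, Finset.mul_sum]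
  exact Finset.sum_congr rfl fun p _ => by ring

lemma energyOf_congr {T : Finset G} {f g : G → ℝ} (h : ∀ x ∈ T, f x = g x) :
    energyOf T f = energyOf T g := energyForm_congr h h h h

lemma addEnergy_eq_energyOf (T A : Finset G) (hA : A ⊆ T) :
    (Finset.addEnergy A A : ℝ) = energyOf T (fun x => if x ∈ A then 1 else 0) := by
  rw [Finset.addEnergy_eq_card_filter, energyOf, energyForm, Finset.card_eq_sum_ones]
  push_cast
  rw [← Finset.sum_filter_add_sum_filter_not
    (s := {p ∈ (T ×ˢ T) ×ˢ (T ×ˢ T) | p.1.1 + p.1.2 = p.2.1 + p.2.2})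
    (p := fun p => p ∈ (A ×ˢ A) ×ˢ (A ×ˢ A))]
  rw [Finset.sum_eq_zero (s := Finset.filter (fun p => ¬ _) _), add_zero]
  · refine Finset.sum_congr ?_ ?_
    · ext ⟨⟨a, b⟩, c, d⟩
      simp only [Finset.mem_filter, Finset.mem_product]
      constructor
      · rintro ⟨⟨⟨h1, h2⟩, h3, h4⟩, h⟩
        exact ⟨⟨⟨⟨hA h1, hA h2⟩, hA h3, hA h4⟩, h⟩, ⟨h1, h2⟩, h3, h4⟩
      · rintro ⟨⟨-, h⟩, h'⟩
        exact ⟨h', h⟩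
    · rintro ⟨⟨a, b⟩, c, d⟩ hp
      simp only [Finset.mem_filter, Finset.mem_product] at hp
      simp [hp.2]
  · rintro ⟨⟨a, b⟩, c, d⟩ hp
    simp only [Finset.mem_filter, Finset.mem_product] at hp
    have := hp.2
    by_contra hne
    simp at hne
    tauto

end EnergyForm

/-! ### Tensorisation over the coordinates of the cube. -/

section Cube

lemma mem_discreteCube {n d : ℕ} {x : Fin d → ℤ} :
    x ∈ discreteCube n d ↔ ∀ i, x i ∈ Finset.Ico (0 : ℤ) n := Fintype.mem_piFinset

lemma cons_mem_discreteCube {n d : ℕ} {i : ℤ} {x : Fin d → ℤ} :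
    (Fin.cons i x : Fin (d + 1) → ℤ) ∈ discreteCube n (d + 1) ↔
      i ∈ Finset.Ico (0 : ℤ) n ∧ x ∈ discreteCube n d := by
  simp only [mem_discreteCube, Fin.forall_fin_succ, Fin.cons_zero, Fin.cons_succ]

lemma mem_discreteCube_succ {n d : ℕ} {x : Fin (d + 1) → ℤ} :
    x ∈ discreteCube n (d + 1) ↔
      x 0 ∈ Finset.Ico (0 : ℤ) n ∧ Fin.tail x ∈ discreteCube n d := by
  simp only [mem_discreteCube, Fin.forall_fin_succ, Fin.tail]

lemma sum_discreteCube_succ (n d : ℕ) (F : (Fin (d + 1) → ℤ) → ℝ) :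
    ∑ x ∈ discreteCube n (d + 1), F x =
      ∑ i ∈ Finset.Ico (0 : ℤ) n, ∑ x ∈ discreteCube n d, F (Fin.cons i x) := by
  rw [← Finset.sum_product']
  refine Finset.sum_nbij' (fun x => (x 0, Fin.tail x)) (fun p => Fin.cons p.1 p.2) ?_ ?_ ?_ ?_ ?_
  · intro x hx
    exact Finset.mem_product.2 (mem_discreteCube_succ.1 hx)
  · intro p hp
    exact cons_mem_discreteCube.2 (Finset.mem_product.1 hp)
  · intro x _; exact Fin.cons_self_tail x
  · intro p _; simp
  · intro x _; simp only [Fin.cons_self_tail]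

lemma cons_add_cons_eq_iff {d : ℕ} {i j k l : ℤ} {x y z w : Fin d → ℤ} :
    (Fin.cons i x : Fin (d + 1) → ℤ) + (Fin.cons j y : Fin (d + 1) → ℤ) =
      (Fin.cons k z : Fin (d + 1) → ℤ) + (Fin.cons l w : Fin (d + 1) → ℤ) ↔
      i + j = k + l ∧ x + y = z + w := by
  simp only [funext_iff, Fin.forall_fin_succ, Pi.add_apply, Fin.cons_zero, Fin.cons_succ]

lemma energyForm_discreteCube_succ (n d : ℕ) (f g h k : (Fin (d + 1) → ℤ) → ℝ) :
    energyForm (discreteCube n (d + 1)) f g h k =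
      ∑ p ∈ (Finset.Ico (0 : ℤ) n ×ˢ Finset.Ico (0 : ℤ) n) ×ˢ
          (Finset.Ico (0 : ℤ) n ×ˢ Finset.Ico (0 : ℤ) n) with p.1.1 + p.1.2 = p.2.1 + p.2.2,
        energyForm (discreteCube n d) (fun x => f (Fin.cons p.1.1 x))
          (fun x => g (Fin.cons p.1.2 x)) (fun x => h (Fin.cons p.2.1 x))
          (fun x => k (Fin.cons p.2.2 x)) := by
  unfold energyForm
  rw [← Finset.sum_product']
  refine Finset.sum_nbij'
    (fun p => (((p.1.1 0, p.1.2 0), (p.2.1 0, p.2.2 0)),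
      ((Fin.tail p.1.1, Fin.tail p.1.2), (Fin.tail p.2.1, Fin.tail p.2.2))))
    (fun q => ((Fin.cons q.1.1.1 q.2.1.1, Fin.cons q.1.1.2 q.2.1.2),
      (Fin.cons q.1.2.1 q.2.2.1, Fin.cons q.1.2.2 q.2.2.2))) ?_ ?_ ?_ ?_ ?_
  · rintro ⟨⟨x, y⟩, z, w⟩ hp
    simp only [Finset.mem_filter, Finset.mem_product, mem_discreteCube_succ] at hp ⊢
    have h2 := hp.2
    rw [← Fin.cons_self_tail x, ← Fin.cons_self_tail y, ← Fin.cons_self_tail z,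
      ← Fin.cons_self_tail w, cons_add_cons_eq_iff] at h2
    tauto
  · rintro ⟨⟨⟨i, j⟩, k, l⟩, ⟨x, y⟩, z, w⟩ hp
    simp only [Finset.mem_filter, Finset.mem_product, cons_mem_discreteCube,
      cons_add_cons_eq_iff] at hp ⊢
    tauto
  · rintro ⟨⟨x, y⟩, z, w⟩ -
    simp only [Fin.cons_self_tail]
  · rintro ⟨⟨⟨i, j⟩, k, l⟩, ⟨x, y⟩, z, w⟩ -
    simp
  · rintro ⟨⟨x, y⟩, z, w⟩ -
    simp only [Fin.cons_self_tail]

/-- A one-dimensional energy inequality tensorises. -/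
lemma energyOf_discreteCube_le {n : ℕ} {t : ℝ} (ht : 0 < t)
    (H : ∀ f : ℤ → ℝ, (∀ x, 0 ≤ f x) →
      energyOf (Finset.Ico (0 : ℤ) n) f ≤ (∑ i ∈ Finset.Ico (0 : ℤ) n, f i ^ (4 / t)) ^ t)
    (d : ℕ) (F : (Fin d → ℤ) → ℝ) (hF : ∀ x, 0 ≤ F x) :
    energyOf (discreteCube n d) F ≤ (∑ x ∈ discreteCube n d, F x ^ (4 / t)) ^ t := by
  induction d with
  | zero =>
    have hc : discreteCube n 0 = {default} := by
      ext x; simp [mem_discreteCube, Subsingleton.elim x default]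
    have h1 : (F default ^ (4 / t)) ^ t = F default ^ 4 := by
      rw [← Real.rpow_mul (hF _), div_mul_cancel₀ _ ht.ne', ← Real.rpow_natCast]; norm_num
    simp only [hc, energyOf, energyForm, Finset.sum_singleton, h1,
      Finset.singleton_product_singleton, Finset.sum_filter]
    simp only [if_true]
    exact le_of_eq (by ring)
  | succ d ih =>
    -- Fourth roots of the energies of the slices: the four-fold Cauchy–Schwarz inequality on slices
    -- bounds `E(F)` by the one-dimensional energy of `g`.
    set g : ℤ → ℝ := fun i => energyOf (discreteCube n d) (fun x => F (Fin.cons i x)) ^ (1 / 4 : ℝ)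
      with hg
    have hg0 : ∀ i, 0 ≤ g i := fun i => Real.rpow_nonneg (energyOf_nonneg _ _) _
    calc energyOf (discreteCube n (d + 1)) F ≤ energyOf (Finset.Ico (0 : ℤ) n) g := by
          rw [energyOf, energyForm_discreteCube_succ]
          exact Finset.sum_le_sum fun p _ => energyForm_le _ _ _ _ _
      _ ≤ (∑ i ∈ Finset.Ico (0 : ℤ) n, g i ^ (4 / t)) ^ t := H g hg0
      _ ≤ _ := by
          refine Real.rpow_le_rpow
            (Finset.sum_nonneg fun i _ => Real.rpow_nonneg (hg0 i) _) ?_ ht.le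
          rw [sum_discreteCube_succ]
          refine Finset.sum_le_sum fun i _ => ?_
          have h0 : 0 ≤ ∑ x ∈ discreteCube n d, F (Fin.cons i x) ^ (4 / t) :=
            Finset.sum_nonneg fun x _ => Real.rpow_nonneg (hF _) _
          calc g i ^ (4 / t)
              ≤ (((∑ x ∈ discreteCube n d, F (Fin.cons i x) ^ (4 / t)) ^ t) ^ (1 / 4 : ℝ))
                  ^ (4 / t) := by
                refine Real.rpow_le_rpow (hg0 i) (Real.rpow_le_rpow (energyOf_nonneg _ _)
                  (ih _ fun x => hF _) (by norm_num)) (by positivity)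
            _ = _ := by
                rw [← Real.rpow_mul h0, ← Real.rpow_mul h0]
                have : t * (1 / 4) * (4 / t) = 1 := by field_simp
                rw [this, Real.rpow_one]

/-- The tensorised inequality is applied to an indicator, which is unchanged by the power `4 / t`.
-/
lemma mem_energyExponents_of_energyOf_le {n : ℕ} {t : ℝ} (ht : 0 < t)
    (H : ∀ f : ℤ → ℝ, (∀ x, 0 ≤ f x) →
      energyOf (Finset.Ico (0 : ℤ) n) f ≤ (∑ i ∈ Finset.Ico (0 : ℤ) n, f i ^ (4 / t)) ^ t) :
    t ∈ energyExponents n := by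
  intro d _ A hA
  rw [addEnergy_eq_energyOf _ A hA]
  refine (energyOf_discreteCube_le ht H d _ fun x => by split_ifs <;> norm_num).trans_eq ?_
  congr 1
  have h4 : (4 / t) ≠ 0 := by positivity
  rw [← Finset.sum_subset hA]
  · rw [Finset.sum_congr rfl (g := fun _ => (1 : ℝ))]
    · simp
    · intro x hx; simp [hx]
  · intro x _ hx; simp [hx, Real.zero_rpow h4]

/-- The tensor power `f ⊗ ⋯ ⊗ f`. -/
noncomputable def tensorPower (d : ℕ) (f : ℤ → ℝ) (x : Fin d → ℤ) : ℝ := ∏ i, f (x i)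

lemma tensorPower_cons (d : ℕ) (f : ℤ → ℝ) (i : ℤ) (x : Fin d → ℤ) :
    tensorPower (d + 1) f (Fin.cons i x) = f i * tensorPower d f x := by
  simp [tensorPower, Fin.prod_univ_succ]

lemma energyOf_tensorPower (n d : ℕ) (f : ℤ → ℝ) :
    energyOf (discreteCube n d) (tensorPower d f) = energyOf (Finset.Ico (0 : ℤ) n) f ^ d := by
  induction d with
  | zero =>
    have hc : discreteCube n 0 = {default} := by
      ext x; simp [mem_discreteCube, Subsingleton.elim x default]
    simp [hc, energyOf, energyForm, Finset.sum_filter, tensorPower]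
  | succ d ih =>
    rw [energyOf, energyForm_discreteCube_succ, pow_succ', ← ih]
    nth_rewrite 1 [energyOf]
    rw [energyForm, Finset.sum_mul]
    refine Finset.sum_congr rfl fun p _ => ?_
    simp only [tensorPower_cons, energyOf, energyForm, Finset.mul_sum]
    exact Finset.sum_congr rfl fun q _ => by ring

lemma sum_tensorPower_rpow (n d : ℕ) {f : ℤ → ℝ} (hf : ∀ x, 0 ≤ f x) (q : ℝ) :
    ∑ x ∈ discreteCube n d, tensorPower d f x ^ q =
      (∑ i ∈ Finset.Ico (0 : ℤ) n, f i ^ q) ^ d := by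
  have h := Finset.prod_univ_sum (fun _ : Fin d => Finset.Ico (0 : ℤ) n) fun _ i => f i ^ q
  rw [Finset.prod_const, Finset.card_univ, Fintype.card_fin] at h
  rw [h]
  refine Finset.sum_congr rfl fun x _ => ?_
  rw [tensorPower, Real.finsetProd_rpow _ _ fun i _ => hf _]

end Cube

/-! ### From sets back to functions: level sets and the tensor power trick. -/

section LevelSets

variable {G : Type*} [AddCommGroup G] [DecidableEq G]

lemma energyOf_level_decomposition (T : Finset G) (F : G → ℝ) :
    energyOf T F = ∑ v ∈ (T.image F ×ˢ T.image F) ×ˢ (T.image F ×ˢ T.image F),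
      energyForm T (fun x => if F x = v.1.1 then v.1.1 else 0)
        (fun x => if F x = v.1.2 then v.1.2 else 0) (fun x => if F x = v.2.1 then v.2.1 else 0)
        (fun x => if F x = v.2.2 then v.2.2 else 0) := by
  simp only [energyOf, energyForm]
  rw [Finset.sum_comm]
  refine Finset.sum_congr rfl ?_
  rintro ⟨⟨a, b⟩, c, d⟩ hp
  simp only [Finset.mem_filter, Finset.mem_product] at hp
  obtain ⟨⟨⟨ha, hb⟩, hc, hd⟩, -⟩ := hp
  rw [Finset.sum_eq_single ((F a, F b), (F c, F d))]
  · simp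
  · rintro ⟨⟨u, v⟩, w, z⟩ - hne
    by_contra h
    simp at h
    apply hne
    simp only [Prod.mk.injEq]
    grind
  · intro h
    exfalso
    apply h
    simp only [Finset.mem_product]
    exact ⟨⟨Finset.mem_image_of_mem _ ha, Finset.mem_image_of_mem _ hb⟩,
      Finset.mem_image_of_mem _ hc, Finset.mem_image_of_mem _ hd⟩

/-- If `E(A) ≤ |A| ^ t` for the subsets of `T`, then a function on `T` satisfies the functional
inequality up to the fourth power of the number of its values. -/
lemma energyOf_le_card_image_pow {T : Finset G} {t : ℝ} (ht : 0 < t)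
    (H : ∀ A ⊆ T, (Finset.addEnergy A A : ℝ) ≤ (A.card : ℝ) ^ t) (F : G → ℝ)
    (hF : ∀ x, 0 ≤ F x) :
    energyOf T F ≤ ((T.image F).card : ℝ) ^ 4 * (∑ x ∈ T, F x ^ (4 / t)) ^ t := by
  classical
  set S : ℝ := ∑ x ∈ T, F x ^ (4 / t) with hS
  have hS0 : 0 ≤ S := Finset.sum_nonneg fun x _ => Real.rpow_nonneg (hF _) _
  -- A single level is `v` times an indicator, so homogeneity reduces it to the hypothesis on sets.
  -- Mixed terms follow from Cauchy–Schwarz.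
  have key : ∀ v ∈ T.image F, energyOf T (fun x => if F x = v then v else 0) ≤ S ^ t := by
    intro v hv
    obtain ⟨y, hy, rfl⟩ := Finset.mem_image.1 hv
    have e1 : (fun x => if F x = F y then F y else 0) =
        fun x => F y * (if F x = F y then 1 else 0) := by
      ext x; split_ifs <;> simp
    set A := {x ∈ T | F x = F y} with hA
    have e2 : energyOf T (fun x => if F x = F y then (1 : ℝ) else 0) = Finset.addEnergy A A := by
      rw [addEnergy_eq_energyOf T A (Finset.filter_subset _ _)]
      exact energyOf_congr fun x hx => by simp [hA, hx]
    rw [e1, energyOf_smul, e2]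
    have h4 : F y ^ 4 = (F y ^ (4 / t)) ^ t := by
      rw [← Real.rpow_mul (hF _), div_mul_cancel₀ _ ht.ne', ← Real.rpow_natCast]; norm_num
    calc F y ^ 4 * (Finset.addEnergy A A : ℝ) ≤ F y ^ 4 * (A.card : ℝ) ^ t :=
          mul_le_mul_of_nonneg_left (H A (Finset.filter_subset _ _)) (pow_nonneg (hF _) _)
      _ = (F y ^ (4 / t) * A.card) ^ t := by
          rw [Real.mul_rpow (Real.rpow_nonneg (hF _) _) (Nat.cast_nonneg _), h4]
      _ ≤ S ^ t := by
          refine Real.rpow_le_rpow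
            (mul_nonneg (Real.rpow_nonneg (hF _) _) (Nat.cast_nonneg _)) ?_ ht.le
          calc F y ^ (4 / t) * A.card = ∑ x ∈ A, F x ^ (4 / t) := by
                rw [Finset.sum_congr rfl (g := fun _ => F y ^ (4 / t)), Finset.sum_const,
                  nsmul_eq_mul, mul_comm]
                intro x hx
                rw [(Finset.mem_filter.1 hx).2]
            _ ≤ S := Finset.sum_le_sum_of_subset_of_nonneg (Finset.filter_subset _ _)
                fun x _ _ => Real.rpow_nonneg (hF _) _
  rw [energyOf_level_decomposition]
  calc _ ≤ ∑ v ∈ (T.image F ×ˢ T.image F) ×ˢ (T.image F ×ˢ T.image F), S ^ t := by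
        refine Finset.sum_le_sum ?_
        rintro ⟨⟨a, b⟩, c, d⟩ hv
        simp only [Finset.mem_product] at hv
        obtain ⟨⟨ha, hb⟩, hc, hd⟩ := hv
        refine le_of_pow_le_pow_left₀ (n := 4) (by norm_num) (Real.rpow_nonneg hS0 _) ?_
        refine (energyForm_pow_four_le _ _ _ _ _).trans ?_
        have e : (S ^ t) ^ 4 = S ^ t * S ^ t * (S ^ t * S ^ t) := by ring
        have h0 := Real.rpow_nonneg hS0 t
        rw [e]
        exact mul_le_mul (mul_le_mul (key _ ha) (key _ hb) (energyOf_nonneg _ _) h0)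
          (mul_le_mul (key _ hc) (key _ hd) (energyOf_nonneg _ _) h0)
          (mul_nonneg (energyOf_nonneg _ _) (energyOf_nonneg _ _)) (by positivity)
    _ = _ := by
        simp only [Finset.sum_const, Finset.card_product, nsmul_eq_mul]
        push_cast; ring

/-- The value at `x` depends only on how often each of the `n` symbols occurs among the coordinates,
and each multiplicity lies in `{0, …, d}`. -/
lemma card_image_tensorPower_le (n d : ℕ) (f : ℤ → ℝ) :
    ((discreteCube n d).image (tensorPower d f)).card ≤ (d + 1) ^ n := by
  classical
  have hsub : (discreteCube n d).image (tensorPower d f) ⊆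
      (Finset.univ : Finset (Fin n → Fin (d + 1))).image
        (fun m => ∏ a : Fin n, f (a : ℕ) ^ (m a : ℕ)) := by
    intro v hv
    obtain ⟨x, hx, rfl⟩ := Finset.mem_image.1 hv
    rw [mem_discreteCube] at hx
    refine Finset.mem_image.2 ⟨fun a => ⟨(Finset.univ.filter fun i => x i = (a : ℕ)).card,
      Nat.lt_succ_of_le ((Finset.card_le_univ _).trans_eq (Fintype.card_fin d))⟩,
      Finset.mem_univ _, ?_⟩
    have hlt : ∀ i, (x i).toNat < n := fun i => by
      have := Finset.mem_Ico.1 (hx i); omega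
    rw [tensorPower, ← Finset.prod_fiberwise_of_maps_to (s := Finset.univ) (t := Finset.univ)
      (g := fun i => (⟨(x i).toNat, hlt i⟩ : Fin n)) (fun _ _ => Finset.mem_univ _)]
    refine Finset.prod_congr rfl fun a _ => ?_
    have e : (Finset.univ.filter fun i => (⟨(x i).toNat, hlt i⟩ : Fin n) = a) =
        Finset.univ.filter fun i => x i = (a : ℕ) := by
      ext i
      have := Finset.mem_Ico.1 (hx i)
      simp only [Finset.mem_filter, Finset.mem_univ, true_and, Fin.ext_iff]
      omega
    rw [e, Finset.prod_congr rfl (g := fun _ => f (a : ℕ)), Finset.prod_const]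
    intro i hi
    rw [(Finset.mem_filter.1 hi).2]
  refine (Finset.card_le_card hsub).trans (Finset.card_image_le.trans_eq ?_)
  simp

lemma le_of_pow_le_poly_mul_pow {a b : ℝ} (hb : 0 ≤ b) (k : ℕ)
    (h : ∀ d : ℕ, 0 < d → a ^ d ≤ ((d : ℝ) + 1) ^ k * b ^ d) : a ≤ b := by
  by_contra! hlt
  rcases hb.eq_or_lt with rfl | hb
  · have := h 1 one_pos
    simp at this
    linarith
  · have ha' : 0 < a := hb.trans hlt
    have hr : 1 < a / b := (one_lt_div hb).2 hlt
    have hlim := tendsto_pow_const_div_const_pow_of_one_lt k hr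
    have h2 := (tendsto_add_atTop_iff_nat 1).2 hlim
    -- The index is shifted to match the factor `(d + 1) ^ k`; the threshold `b / a` absorbs the
    -- extra power of `a / b` in the denominator.
    have h3 := h2.eventually_lt_const (u := b / a) (by positivity)
    obtain ⟨d, hd, hd1⟩ := (h3.and (eventually_gt_atTop 0)).exists
    have := h d hd1
    rw [div_lt_iff₀ (by positivity)] at hd
    have e : b / a * (a / b) ^ (d + 1) = a ^ d / b ^ d := by
      rw [pow_succ, div_pow]; field_simp
    rw [e, lt_div_iff₀ (by positivity)] at hd
    push_cast at hd
    linarith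

lemma energyOf_le_of_mem_energyExponents {n : ℕ} {t : ℝ} (ht : 0 < t)
    (H : t ∈ energyExponents n) (f : ℤ → ℝ) (hf : ∀ x, 0 ≤ f x) :
    energyOf (Finset.Ico (0 : ℤ) n) f ≤ (∑ i ∈ Finset.Ico (0 : ℤ) n, f i ^ (4 / t)) ^ t := by
  have hS0 : 0 ≤ ∑ i ∈ Finset.Ico (0 : ℤ) n, f i ^ (4 / t) :=
    Finset.sum_nonneg fun x _ => Real.rpow_nonneg (hf _) _
  refine le_of_pow_le_poly_mul_pow (Real.rpow_nonneg hS0 _) (n * 4) ?_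
  intro d hd
  have h1 := energyOf_le_card_image_pow ht (H d hd) (tensorPower d f)
    fun x => Finset.prod_nonneg fun i _ => hf _
  rw [energyOf_tensorPower, sum_tensorPower_rpow n d hf] at h1
  refine h1.trans ?_
  have e : ((∑ i ∈ Finset.Ico (0 : ℤ) n, f i ^ (4 / t)) ^ d) ^ t =
      ((∑ i ∈ Finset.Ico (0 : ℤ) n, f i ^ (4 / t)) ^ t) ^ d := by
    rw [← Real.rpow_natCast, ← Real.rpow_natCast, ← Real.rpow_mul hS0, ← Real.rpow_mul hS0,
      mul_comm]
  rw [e, pow_mul]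
  refine mul_le_mul_of_nonneg_right ?_ (by positivity)
  have := card_image_tensorPower_le n d f
  gcongr
  exact_mod_cast this

end LevelSets

/-! ### Stability of Young's inequality away from point masses. -/

section Stability

/-- The Bhattacharyya correlation of `u ^ 4` on `S` and its translate by `δ`. -/
noncomputable def shiftCorr (S : Finset ℤ) (u : ℤ → ℝ) (δ : ℤ) : ℝ :=
  ∑ p ∈ S ×ˢ S with p.1 - p.2 = δ, u p.1 ^ 2 * u p.2 ^ 2

lemma sum_fst_le_of_sub_eq {A : Finset (ℤ × ℤ)} {B : Finset ℤ} {δ : ℤ} {h : ℤ → ℝ}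
    (hA : ∀ p ∈ A, p.1 - p.2 = δ) (hB : ∀ p ∈ A, p.1 ∈ B) (hh : ∀ x, 0 ≤ h x) :
    ∑ p ∈ A, h p.1 ≤ ∑ a ∈ B, h a := by
  rw [← Finset.sum_image (s := A) (g := Prod.fst) (f := h)]
  · refine Finset.sum_le_sum_of_subset_of_nonneg ?_ fun x _ _ => hh x
    intro x hx
    obtain ⟨p, hp, rfl⟩ := Finset.mem_image.1 hx
    exact hB p hp
  · rintro ⟨a, b⟩ hp ⟨c, d⟩ hq hpq
    have h1 := hA _ hp
    have h2 := hA _ hq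
    simp only at h1 h2 hpq
    ext <;> simp <;> omega

lemma sum_snd_le_of_sub_eq {A : Finset (ℤ × ℤ)} {B : Finset ℤ} {δ : ℤ} {h : ℤ → ℝ}
    (hA : ∀ p ∈ A, p.1 - p.2 = δ) (hB : ∀ p ∈ A, p.2 ∈ B) (hh : ∀ x, 0 ≤ h x) :
    ∑ p ∈ A, h p.2 ≤ ∑ a ∈ B, h a := by
  rw [← Finset.sum_image (s := A) (g := Prod.snd) (f := h)]
  · refine Finset.sum_le_sum_of_subset_of_nonneg ?_ fun x _ _ => hh x
    intro x hx
    obtain ⟨p, hp, rfl⟩ := Finset.mem_image.1 hx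
    exact hB p hp
  · rintro ⟨a, b⟩ hp ⟨c, d⟩ hq hpq
    have h1 := hA _ hp
    have h2 := hA _ hq
    simp only at h1 h2 hpq
    ext <;> simp <;> omega

/-- Cauchy–Schwarz, plus the fact that on pairs of fixed difference both projections are injective.
-/
lemma sum_sq_mul_sq_sq_le {A : Finset (ℤ × ℤ)} {B C : Finset ℤ} {δ : ℤ} (u : ℤ → ℝ)
    (hA : ∀ p ∈ A, p.1 - p.2 = δ) (hB : ∀ p ∈ A, p.1 ∈ B) (hC : ∀ p ∈ A, p.2 ∈ C) :
    (∑ p ∈ A, u p.1 ^ 2 * u p.2 ^ 2) ^ 2 ≤ (∑ a ∈ B, u a ^ 4) * ∑ a ∈ C, u a ^ 4 := by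
  have h4 : ∀ x, 0 ≤ u x ^ 4 := fun x => by positivity
  calc _ ≤ (∑ p ∈ A, (u p.1 ^ 2) ^ 2) * ∑ p ∈ A, (u p.2 ^ 2) ^ 2 :=
        Finset.sum_mul_sq_le_sq_mul_sq _ _ _
    _ = (∑ p ∈ A, u p.1 ^ 4) * ∑ p ∈ A, u p.2 ^ 4 := by simp only [← pow_mul]
    _ ≤ _ := mul_le_mul (sum_fst_le_of_sub_eq (h := fun x => u x ^ 4) hA hB h4)
        (sum_snd_le_of_sub_eq (h := fun x => u x ^ 4) hA hC h4)
        (Finset.sum_nonneg fun p _ => h4 _) (Finset.sum_nonneg fun p _ => h4 _)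

lemma shiftCorr_le (S : Finset ℤ) (u : ℤ → ℝ) (δ : ℤ) : shiftCorr S u δ ≤ ∑ a ∈ S, u a ^ 4 := by
  have h := sum_sq_mul_sq_sq_le (A := {p ∈ S ×ˢ S | p.1 - p.2 = δ}) (B := S) (C := S) u
    (fun p hp => (Finset.mem_filter.1 hp).2)
    (fun p hp => (Finset.mem_product.1 (Finset.mem_filter.1 hp).1).1)
    (fun p hp => (Finset.mem_product.1 (Finset.mem_filter.1 hp).1).2)
  rw [← sq] at h
  exact le_of_sq_le_sq h (Finset.sum_nonneg fun p _ => by positivity)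

/-- Cauchy–Schwarz on each autocorrelation, with the summand split as `u^3 u^3 = (u^2 u^2)(u u)`:
one factor yields the weights `u^4 u^4`, the other the shifted correlation. -/
lemma energyOf_cube_le_sum_shiftCorr (S : Finset ℤ) (u : ℤ → ℝ) :
    energyOf S (fun x => u x ^ 3) ≤
      ∑ p ∈ S ×ˢ S, u p.1 ^ 4 * u p.2 ^ 4 * shiftCorr S u (p.1 - p.2) := by
  rw [energyOf_eq_sum_sq, ← Finset.sum_fiberwise_of_maps_to (s := S ×ˢ S)
    (t := (S ×ˢ S).image fun p => p.1 - p.2) (g := fun p => p.1 - p.2)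
    (fun p hp => Finset.mem_image_of_mem _ hp)]
  refine Finset.sum_le_sum fun δ _ => ?_
  have e : ∑ p ∈ S ×ˢ S with p.1 - p.2 = δ, u p.1 ^ 4 * u p.2 ^ 4 * shiftCorr S u (p.1 - p.2) =
      (∑ p ∈ S ×ˢ S with p.1 - p.2 = δ, (u p.1 ^ 2 * u p.2 ^ 2) ^ 2) *
        ∑ p ∈ S ×ˢ S with p.1 - p.2 = δ, (u p.1 * u p.2) ^ 2 := by
    rw [Finset.sum_mul]
    refine Finset.sum_congr rfl fun p hp => ?_
    rw [(Finset.mem_filter.1 hp).2, shiftCorr]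
    simp only [mul_pow, ← pow_mul]
  rw [e]
  refine le_of_eq_of_le ?_ (Finset.sum_mul_sq_le_sq_mul_sq _ _ _)
  congr 1
  exact Finset.sum_congr rfl fun p _ => by ring

/-- Young's inequality `‖f * f‖₂² ≤ ‖f‖_{4/3}⁴`, for `f = u ^ 3`. -/
lemma energyOf_cube_le (S : Finset ℤ) (u : ℤ → ℝ) :
    energyOf S (fun x => u x ^ 3) ≤ (∑ a ∈ S, u a ^ 4) ^ 3 := by
  refine (energyOf_cube_le_sum_shiftCorr S u).trans ?_
  calc _ ≤ ∑ p ∈ S ×ˢ S, u p.1 ^ 4 * u p.2 ^ 4 * ∑ a ∈ S, u a ^ 4 :=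
        Finset.sum_le_sum fun p _ => mul_le_mul_of_nonneg_left (shiftCorr_le _ _ _) (by positivity)
    _ = _ := by
        rw [← Finset.sum_mul, Finset.sum_product]
        simp only
        rw [← Finset.sum_mul_sum]; ring

/-- Hellinger against total variation for two-point distributions: AM–GM on the complements leaves
the deficit `(√p - √q)^2 / 2`, and `|p - q| ≤ 2 |√p - √q|`. -/
lemma add_le_one_sub_sq_of_sq_le {A B p q : ℝ} (hp : 0 ≤ p) (hp1 : p ≤ 1)
    (hq : 0 ≤ q) (hq1 : q ≤ 1) (hA : A ^ 2 ≤ p * q) (hB : B ^ 2 ≤ (1 - p) * (1 - q)) :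
    A + B ≤ 1 - (p - q) ^ 2 / 8 := by
  have h1 : A ≤ √p * √q := by
    rw [← Real.sqrt_mul hp]; exact Real.le_sqrt_of_sq_le hA
  have h2 : B ≤ √(1 - p) * √(1 - q) := by
    rw [← Real.sqrt_mul (by linarith)]; exact Real.le_sqrt_of_sq_le hB
  have e1 := Real.sq_sqrt hp
  have e2 := Real.sq_sqrt hq
  have e3 := Real.sq_sqrt (sub_nonneg.2 hp1)
  have e4 := Real.sq_sqrt (sub_nonneg.2 hq1)
  have h5 : √(1 - p) * √(1 - q) ≤ ((1 - p) + (1 - q)) / 2 := by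
    nlinarith [sq_nonneg (√(1 - p) - √(1 - q))]
  have h6 : (p - q) ^ 2 ≤ 4 * (√p - √q) ^ 2 := by
    have e : (p - q) ^ 2 = (√p + √q) ^ 2 * (√p - √q) ^ 2 := by
      rw [← mul_pow, ← sq_sub_sq, e1, e2]
    rw [e]
    refine mul_le_mul_of_nonneg_right ?_ (sq_nonneg _)
    nlinarith [Real.sqrt_le_one.2 hp1, Real.sqrt_le_one.2 hq1, Real.sqrt_nonneg p,
      Real.sqrt_nonneg q]
  nlinarith

/-- If `u ^ 4` is a probability distribution, then its correlation with its translate by `δ` is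
bounded away from `1` in terms of the mass of any interval of length `δ`. -/
lemma shiftCorr_le_one_sub {S : Finset ℤ} {u : ℤ → ℝ} (hu : ∑ a ∈ S, u a ^ 4 = 1) {δ : ℤ}
    (hδ : 0 ≤ δ) (x : ℤ) :
    shiftCorr S u δ ≤ 1 - (∑ a ∈ S with x - δ < a ∧ a ≤ x, u a ^ 4) ^ 2 / 8 := by
  have hnn : ∀ B : Finset ℤ, 0 ≤ ∑ a ∈ B, u a ^ 4 := fun B =>
    Finset.sum_nonneg fun p _ => by positivity
  -- For a pair of difference `δ`, the first entry is at most `x` iff the second is at most `x - δ`.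
  -- The correlation thus splits at the cut, with masses `p, q` on one side and `1 - p, 1 - q` on
  -- the other.
  set p := ∑ a ∈ S with a ≤ x, u a ^ 4 with hp
  set q := ∑ a ∈ S with a ≤ x - δ, u a ^ 4 with hq
  have hp' : ∑ a ∈ S with ¬ a ≤ x, u a ^ 4 = 1 - p := by
    rw [← hu, hp, ← Finset.sum_filter_add_sum_filter_not S (fun a => a ≤ x)]; ring
  have hq' : ∑ a ∈ S with ¬ a ≤ x - δ, u a ^ 4 = 1 - q := by
    rw [← hu, hq, ← Finset.sum_filter_add_sum_filter_not S (fun a => a ≤ x - δ)]; ring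
  have hpq : ∑ a ∈ S with x - δ < a ∧ a ≤ x, u a ^ 4 = p - q := by
    rw [hp, hq, ← Finset.sum_filter_add_sum_filter_not {a ∈ S | a ≤ x} (fun a => a ≤ x - δ)]
    rw [Finset.filter_filter, Finset.filter_filter]
    have e1 : Finset.filter (fun a => a ≤ x ∧ a ≤ x - δ) S = Finset.filter (fun a => a ≤ x - δ) S :=
      Finset.filter_congr fun a _ => by omega
    have e2 : Finset.filter (fun a => a ≤ x ∧ ¬ a ≤ x - δ) S =
        Finset.filter (fun a => x - δ < a ∧ a ≤ x) S :=
      Finset.filter_congr fun a _ => by omega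
    rw [e1, e2]; ring
  rw [hpq, shiftCorr, ← Finset.sum_filter_add_sum_filter_not _ (fun r : ℤ × ℤ => r.1 ≤ x)]
  refine add_le_one_sub_sq_of_sq_le (hnn _) (by linarith [hnn {a ∈ S | ¬ a ≤ x}]) (hnn _)
    (by linarith [hnn {a ∈ S | ¬ a ≤ x - δ}]) ?_ ?_
  · refine sum_sq_mul_sq_sq_le (δ := δ) u ?_ ?_ ?_ <;>
    · rintro ⟨a, b⟩ h
      simp only [Finset.mem_filter, Finset.mem_product] at h ⊢
      first | omega | exact ⟨by tauto, by omega⟩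
  · rw [← hp', ← hq']
    refine sum_sq_mul_sq_sq_le (δ := δ) u ?_ ?_ ?_ <;>
    · rintro ⟨a, b⟩ h
      simp only [Finset.mem_filter, Finset.mem_product] at h ⊢
      first | omega | exact ⟨by tauto, by omega⟩

/-- The closed interval `[b, a]` has one point too many for a window of length `a - b`, so two
windows, ending at `a` and `a - 1`, cover it. Hence `32 = 2 · (8 + 8)`. -/
lemma sq_mass_Icc_le {S : Finset ℤ} {u : ℤ → ℝ} (hu : ∑ a ∈ S, u a ^ 4 = 1) {a b : ℤ}
    (hab : b < a) :
    (∑ c ∈ S with b ≤ c ∧ c ≤ a, u c ^ 4) ^ 2 ≤ 32 * (1 - shiftCorr S u (a - b)) := by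
  have h1 := shiftCorr_le_one_sub hu (sub_nonneg.2 hab.le) a
  have h2 := shiftCorr_le_one_sub hu (sub_nonneg.2 hab.le) (a - 1)
  set w₁ := ∑ c ∈ S with a - (a - b) < c ∧ c ≤ a, u c ^ 4
  set w₂ := ∑ c ∈ S with a - 1 - (a - b) < c ∧ c ≤ a - 1, u c ^ 4
  have h3 : ∑ c ∈ S with b ≤ c ∧ c ≤ a, u c ^ 4 ≤ w₁ + w₂ := by
    simp only [w₁, w₂, Finset.sum_filter]
    rw [← Finset.sum_add_distrib]
    refine Finset.sum_le_sum fun c _ => ?_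
    have : 0 ≤ u c ^ 4 := by positivity
    split_ifs <;> first | omega | linarith
  have h4 : 0 ≤ ∑ c ∈ S with b ≤ c ∧ c ≤ a, u c ^ 4 :=
    Finset.sum_nonneg fun p _ => by positivity
  nlinarith [sq_nonneg (w₁ - w₂), pow_le_pow_left₀ h4 h3 2]

/-- Among three integers not all equal, some labelling as maximum, minimum and middle has maximum
above minimum. There are six labellings, of equal total weight by symmetry. -/
lemma sum_cube_add_six_mul_ge {S : Finset ℤ} {y : ℤ → ℝ} (hy : ∀ a, 0 ≤ y a) :
    (∑ a ∈ S, y a) ^ 3 ≤ ∑ a ∈ S, y a ^ 3 +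
      6 * ∑ a ∈ S, ∑ b ∈ S, ∑ c ∈ S,
        if b < a ∧ b ≤ c ∧ c ≤ a then y a * y b * y c else 0 := by
  set φ : ℤ → ℤ → ℤ → ℝ := fun a b c =>
    if b < a ∧ b ≤ c ∧ c ≤ a then y a * y b * y c else 0 with hφ
  have hφ0 : ∀ a b c, 0 ≤ φ a b c := fun a b c => by
    have := hy a; have := hy b; have := hy c
    simp only [hφ]; split_ifs <;> positivity
  have hpt : ∀ a b c, y a * y b * y c ≤ (if b = a then if c = a then y a ^ 3 else 0 else 0) +
      (φ a b c + φ a c b + φ b a c + φ b c a + φ c a b + φ c b a) := by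
    intro a b c
    by_cases h : b = a ∧ c = a
    · obtain ⟨rfl, rfl⟩ := h
      have := hφ0 c c c
      simp only [if_true]
      have e : y c * y c * y c = y c ^ 3 := by ring
      linarith
    · have h0 : 0 ≤ (if b = a then if c = a then y a ^ 3 else 0 else 0 : ℝ) := by
        have := hy a
        split_ifs <;> positivity
      have h1 := hφ0 a b c; have h2 := hφ0 a c b; have h3 := hφ0 b a c
      have h4 := hφ0 b c a; have h5 := hφ0 c a b; have h6 := hφ0 c b a
      have : (b < a ∧ b ≤ c ∧ c ≤ a) ∨ (c < a ∧ c ≤ b ∧ b ≤ a) ∨ (a < b ∧ a ≤ c ∧ c ≤ b) ∨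
          (c < b ∧ c ≤ a ∧ a ≤ b) ∨ (a < c ∧ a ≤ b ∧ b ≤ c) ∨ (b < c ∧ b ≤ a ∧ a ≤ c) := by
        omega
      rcases this with h' | h' | h' | h' | h' | h'
      · have e : φ a b c = y a * y b * y c := by simp only [hφ]; rw [if_pos h']
        linarith
      · have e : φ a c b = y a * y b * y c := by simp only [hφ]; rw [if_pos h']; ring
        linarith
      · have e : φ b a c = y a * y b * y c := by simp only [hφ]; rw [if_pos h']; ring
        linarith
      · have e : φ b c a = y a * y b * y c := by simp only [hφ]; rw [if_pos h']; ring
        linarith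
      · have e : φ c a b = y a * y b * y c := by simp only [hφ]; rw [if_pos h']; ring
        linarith
      · have e : φ c b a = y a * y b * y c := by simp only [hφ]; rw [if_pos h']; ring
        linarith
  set T := ∑ a ∈ S, ∑ b ∈ S, ∑ c ∈ S, φ a b c with hT
  have swap23 : ∀ ψ : ℤ → ℤ → ℤ → ℝ,
      ∑ a ∈ S, ∑ b ∈ S, ∑ c ∈ S, ψ a c b = ∑ a ∈ S, ∑ b ∈ S, ∑ c ∈ S, ψ a b c := fun ψ =>
    Finset.sum_congr rfl fun a _ => Finset.sum_comm
  have swap12 : ∀ ψ : ℤ → ℤ → ℤ → ℝ,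
      ∑ a ∈ S, ∑ b ∈ S, ∑ c ∈ S, ψ b a c = ∑ a ∈ S, ∑ b ∈ S, ∑ c ∈ S, ψ a b c := fun ψ =>
    Finset.sum_comm
  have e1 : ∑ a ∈ S, ∑ b ∈ S, ∑ c ∈ S, φ a c b = T := swap23 φ
  have e2 : ∑ a ∈ S, ∑ b ∈ S, ∑ c ∈ S, φ b a c = T := swap12 φ
  have e3 : ∑ a ∈ S, ∑ b ∈ S, ∑ c ∈ S, φ b c a = T := by
    rw [swap12 fun a b c => φ a c b, e1]
  have e4 : ∑ a ∈ S, ∑ b ∈ S, ∑ c ∈ S, φ c a b = T := by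
    rw [swap23 fun a b c => φ b a c, e2]
  have e5 : ∑ a ∈ S, ∑ b ∈ S, ∑ c ∈ S, φ c b a = T := by
    rw [swap12 fun a b c => φ c a b, e4]
  have hcube : (∑ a ∈ S, y a) ^ 3 = ∑ a ∈ S, ∑ b ∈ S, ∑ c ∈ S, y a * y b * y c := by
    rw [pow_three', Finset.sum_mul_sum, Finset.sum_mul]
    refine Finset.sum_congr rfl fun a _ => ?_
    rw [Finset.sum_mul_sum]
  have hdiag : ∑ a ∈ S, ∑ b ∈ S, ∑ c ∈ S,
      (if b = a then if c = a then y a ^ 3 else 0 else 0 : ℝ) = ∑ a ∈ S, y a ^ 3 := by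
    refine Finset.sum_congr rfl fun a ha => ?_
    rw [Finset.sum_eq_single_of_mem a ha (fun b _ hb => by simp [hb])]
    simp [ha]
  calc (∑ a ∈ S, y a) ^ 3 ≤ ∑ a ∈ S, ∑ b ∈ S, ∑ c ∈ S,
        ((if b = a then if c = a then y a ^ 3 else 0 else 0) +
          (φ a b c + φ a c b + φ b a c + φ b c a + φ c a b + φ c b a)) := by
        rw [hcube]
        exact Finset.sum_le_sum fun a _ => Finset.sum_le_sum fun b _ =>
          Finset.sum_le_sum fun c _ => hpt a b c
    _ = _ := by
        simp only [Finset.sum_add_distrib]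
        rw [hdiag, e1, e2, e3, e4, e5]
        ring

/-- A quantitative stability version of Young's inequality on `ℤ`: a loss occurs unless the
distribution `u ^ 4` is concentrated at a point. -/
lemma energyOf_cube_le_of_not_concentrated {S : Finset ℤ} {u : ℤ → ℝ} {η : ℝ}
    (hη : 0 ≤ η)
    (hu : ∑ a ∈ S, u a ^ 4 = 1) (hmax : ∀ a ∈ S, u a ^ 4 ≤ 1 - η) :
    energyOf S (fun x => u x ^ 3) ≤ 1 - η ^ 2 / 1152 := by
  have h4 : ∀ x, 0 ≤ u x ^ 4 := fun x => by positivity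
  set P : ℤ × ℤ → ℝ := fun p => if p.2 < p.1 then ∑ c ∈ S with p.2 ≤ c ∧ c ≤ p.1, u c ^ 4 else 0
    with hP
  have hcorr : ∀ p, P p ^ 2 / 32 ≤ 1 - shiftCorr S u (p.1 - p.2) := by
    intro p
    simp only [hP]
    split_ifs with h
    · linarith [sq_mass_Icc_le hu h]
    · have := shiftCorr_le S u (p.1 - p.2)
      rw [hu] at this
      simpa using this
  have hone : ∑ p ∈ S ×ˢ S, u p.1 ^ 4 * u p.2 ^ 4 = 1 := by
    rw [Finset.sum_product]
    simp only
    rw [← Finset.sum_mul_sum, hu, one_mul]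
  set T := ∑ p ∈ S ×ˢ S, u p.1 ^ 4 * u p.2 ^ 4 * P p with hT
  -- Jensen for the probability weights `u^4 u^4`: only the mean `T` of the intermediate mass has to
  -- be bounded below.
  have hTT : T ^ 2 ≤ ∑ p ∈ S ×ˢ S, u p.1 ^ 4 * u p.2 ^ 4 * P p ^ 2 := by
    have := Finset.sum_mul_sq_le_sq_mul_sq (S ×ˢ S) (fun p : ℤ × ℤ => u p.1 ^ 2 * u p.2 ^ 2)
      (fun p => u p.1 ^ 2 * u p.2 ^ 2 * P p)
    have e1 : ∑ p ∈ S ×ˢ S, (u p.1 ^ 2 * u p.2 ^ 2) ^ 2 = 1 := by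
      rw [← hone]; exact Finset.sum_congr rfl fun p _ => by ring
    rw [e1, one_mul] at this
    refine le_trans (le_of_eq ?_) (this.trans_eq ?_)
    · rw [hT]; congr 1; exact Finset.sum_congr rfl fun p _ => by ring
    · exact Finset.sum_congr rfl fun p _ => by ring
  have hT6 : 1 ≤ ∑ a ∈ S, (u a ^ 4) ^ 3 + 6 * T := by
    have := sum_cube_add_six_mul_ge (S := S) (y := fun a => u a ^ 4) h4
    rw [hu, one_pow] at this
    refine this.trans_eq ?_
    congr 2
    rw [hT, Finset.sum_product]
    refine Finset.sum_congr rfl fun a _ => Finset.sum_congr rfl fun b _ => ?_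
    simp only [hP]
    by_cases h : b < a
    · simp [h, Finset.mul_sum, Finset.sum_filter]
    · simp [h]
  have hcub : ∑ a ∈ S, (u a ^ 4) ^ 3 ≤ 1 - η := by
    calc _ ≤ ∑ a ∈ S, (1 - η) * u a ^ 4 := by
          refine Finset.sum_le_sum fun a ha => ?_
          have h1 := hmax a ha
          have h2 := h4 a
          have h3 : (u a ^ 4) ^ 2 ≤ 1 - η := by nlinarith
          nlinarith
      _ = 1 - η := by rw [← Finset.mul_sum, hu, mul_one]
  have hTη : η / 6 ≤ T := by linarith
  have hmain : energyOf S (fun x => u x ^ 3) ≤ 1 - T ^ 2 / 32 := by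
    calc _ ≤ ∑ p ∈ S ×ˢ S, u p.1 ^ 4 * u p.2 ^ 4 * shiftCorr S u (p.1 - p.2) :=
          energyOf_cube_le_sum_shiftCorr S u
      _ ≤ ∑ p ∈ S ×ˢ S, (u p.1 ^ 4 * u p.2 ^ 4 - u p.1 ^ 4 * u p.2 ^ 4 * P p ^ 2 / 32) := by
          refine Finset.sum_le_sum fun p _ => ?_
          have h1 := mul_le_mul_of_nonneg_left (hcorr p) (mul_nonneg (h4 p.1) (h4 p.2))
          linarith
      _ = 1 - (∑ p ∈ S ×ˢ S, u p.1 ^ 4 * u p.2 ^ 4 * P p ^ 2) / 32 := by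
          rw [Finset.sum_sub_distrib, hone, Finset.sum_div]
      _ ≤ _ := by linarith
  -- `1152 = 32 · 6 ^ 2`, from the gain `T ^ 2 / 32` and `T ≥ η / 6`.
  nlinarith [pow_le_pow_left₀ (by positivity) hTη 2]

end Stability

/-! ### Perturbation around a point mass. -/

section Concentrated

lemma sum_comp_le_sum_of_injective {S D : Finset ℤ} {h : ℤ → ℝ} {φ : ℤ → ℤ}
    (hφ : Function.Injective φ) (hh : ∀ x, 0 ≤ h x) (hS : ∀ x, x ∉ S → h x = 0) :
    ∑ δ ∈ D, h (φ δ) ≤ ∑ x ∈ S, h x := by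
  rw [← Finset.sum_image (s := D) (g := φ) (f := h) hφ.injOn,
    ← Finset.sum_filter_of_ne (s := D.image φ) (p := fun x => x ∈ S)]
  · refine Finset.sum_le_sum_of_subset_of_nonneg ?_ fun x _ _ => hh x
    intro x hx
    exact (Finset.mem_filter.1 hx).2
  · intro x _ hx
    by_contra h
    exact hx (hS x h)

/-- The energy of `f` compared with that of the function `g` obtained by removing the point `i₀`. -/
lemma energyOf_le_of_remove_point {S : Finset ℤ} {f g : ℤ → ℝ} {i₀ : ℤ} (hi : i₀ ∈ S)
    (hg : g = fun x => if x ∈ S ∧ x ≠ i₀ then f x else 0) :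
    energyOf S f ≤ (f i₀ ^ 2 + ∑ x ∈ S, g x ^ 2) ^ 2 + 6 * f i₀ ^ 2 * ∑ x ∈ S, g x ^ 2 +
      3 * energyOf S g := by
  have hgS : ∀ x, x ∉ S → g x = 0 := fun x hx => by simp [hg, hx]
  have hgi : g i₀ = 0 := by simp [hg]
  have hgf : ∀ x ∈ S, x ≠ i₀ → g x = f x := fun x hx h => by simp [hg, hx, h]
  set D := (S ×ˢ S).image (fun p => p.1 - p.2) with hD
  have h0D : (0 : ℤ) ∈ D := Finset.mem_image.2 ⟨(i₀, i₀), Finset.mk_mem_product hi hi, sub_self _⟩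
  have hR0 : ∑ p ∈ S ×ˢ S with p.1 - p.2 = 0, f p.1 * f p.2 = f i₀ ^ 2 + ∑ x ∈ S, g x ^ 2 := by
    have e1 : ∑ p ∈ S ×ˢ S with p.1 - p.2 = 0, f p.1 * f p.2 = ∑ x ∈ S, f x ^ 2 := by
      refine Finset.sum_nbij' (fun p => p.1) (fun x => (x, x)) ?_ ?_ ?_ ?_ ?_
      · rintro ⟨a, b⟩ h
        simp only [Finset.mem_filter, Finset.mem_product] at h
        exact h.1.1
      · intro a h; simp [h]
      · rintro ⟨a, b⟩ h
        simp only [Finset.mem_filter, Finset.mem_product] at h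
        ext <;> simp; omega
      · simp
      · rintro ⟨a, b⟩ h
        simp only [Finset.mem_filter, Finset.mem_product] at h
        have : a = b := by omega
        subst this; ring
    rw [e1, ← Finset.add_sum_erase _ _ hi, ← Finset.add_sum_erase S (fun x => g x ^ 2) hi, hgi]
    have : ∑ x ∈ S.erase i₀, f x ^ 2 = ∑ x ∈ S.erase i₀, g x ^ 2 :=
      Finset.sum_congr rfl fun x hx => by
        rw [hgf x (Finset.mem_of_mem_erase hx) (Finset.ne_of_mem_erase hx)]
    rw [this]; ring
  -- At a nonzero difference at most one entry of a pair can be `i₀`, so only two cross terms are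
  -- added to the autocorrelation of `g`.
  have hR : ∀ δ, δ ≠ 0 → ∑ p ∈ S ×ˢ S with p.1 - p.2 = δ, f p.1 * f p.2 =
      f i₀ * g (i₀ - δ) + f i₀ * g (i₀ + δ) +
        ∑ p ∈ S ×ˢ S with p.1 - p.2 = δ, g p.1 * g p.2 := by
    intro δ hδ
    have e1 : ∑ p ∈ S ×ˢ S with p.1 - p.2 = δ, (if p.1 = i₀ then f i₀ * g p.2 else 0) =
        f i₀ * g (i₀ - δ) := by
      rw [Finset.sum_eq_single (i₀, i₀ - δ)]
      · simp
      · rintro ⟨a, b⟩ h hne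
        simp only [Finset.mem_filter, Finset.mem_product] at h
        rw [if_neg]
        rintro rfl
        apply hne
        ext <;> simp; omega
      · intro h
        simp only [Finset.mem_filter, Finset.mem_product] at h
        have : i₀ - δ ∉ S := fun h' => h ⟨⟨hi, h'⟩, by ring⟩
        simp [hgS _ this]
    have e2 : ∑ p ∈ S ×ˢ S with p.1 - p.2 = δ, (if p.2 = i₀ then f i₀ * g p.1 else 0) =
        f i₀ * g (i₀ + δ) := by
      rw [Finset.sum_eq_single (i₀ + δ, i₀)]
      · simp
      · rintro ⟨a, b⟩ h hne
        simp only [Finset.mem_filter, Finset.mem_product] at h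
        rw [if_neg]
        rintro rfl
        apply hne
        ext <;> simp; omega
      · intro h
        simp only [Finset.mem_filter, Finset.mem_product] at h
        have : i₀ + δ ∉ S := fun h' => h ⟨⟨h', hi⟩, by ring⟩
        simp [hgS _ this]
    rw [← e1, ← e2, ← Finset.sum_add_distrib, ← Finset.sum_add_distrib]
    refine Finset.sum_congr rfl ?_
    rintro ⟨a, b⟩ h
    simp only [Finset.mem_filter, Finset.mem_product] at h ⊢
    by_cases ha : a = i₀
    · have hb : b ≠ i₀ := by omega
      rw [if_pos ha, if_neg hb, ha, hgi, hgf b h.1.2 hb]; ring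
    · by_cases hb : b = i₀
      · rw [if_neg ha, if_pos hb, hb, hgi, hgf a h.1.1 ha]; ring
      · rw [if_neg ha, if_neg hb, hgf a h.1.1 ha, hgf b h.1.2 hb]; ring
  have hG : ∀ φ : ℤ → ℤ, Function.Injective φ →
      ∑ δ ∈ D.erase 0, g (φ δ) ^ 2 ≤ ∑ x ∈ S, g x ^ 2 := fun φ hφ =>
    sum_comp_le_sum_of_injective (h := fun x => g x ^ 2) hφ (fun x => sq_nonneg _)
      fun x hx => by simp [hgS x hx]
  have hE : ∑ δ ∈ D.erase 0, (∑ p ∈ S ×ˢ S with p.1 - p.2 = δ, g p.1 * g p.2) ^ 2 ≤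
      energyOf S g := by
    rw [energyOf_eq_sum_sq]
    exact Finset.sum_le_sum_of_subset_of_nonneg (Finset.erase_subset _ _) fun _ _ _ => sq_nonneg _
  have h1 := hG (fun δ => i₀ - δ) (fun a b h => by simpa using h)
  have h2 := hG (fun δ => i₀ + δ) (fun a b h => by simpa using h)
  rw [energyOf_eq_sum_sq, ← hD, ← Finset.add_sum_erase _ _ h0D, hR0]
  have h3 : ∑ δ ∈ D.erase 0, (∑ p ∈ S ×ˢ S with p.1 - p.2 = δ, f p.1 * f p.2) ^ 2 ≤
      3 * f i₀ ^ 2 * ∑ δ ∈ D.erase 0, g (i₀ - δ) ^ 2 +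
      3 * f i₀ ^ 2 * ∑ δ ∈ D.erase 0, g (i₀ + δ) ^ 2 +
      3 * ∑ δ ∈ D.erase 0, (∑ p ∈ S ×ˢ S with p.1 - p.2 = δ, g p.1 * g p.2) ^ 2 := by
    simp only [Finset.mul_sum (s := D.erase 0), ← Finset.sum_add_distrib]
    refine Finset.sum_le_sum fun δ hδ => ?_
    rw [hR δ (Finset.ne_of_mem_erase hδ)]
    set x := f i₀ * g (i₀ - δ) with hx
    set y := f i₀ * g (i₀ + δ) with hy
    set z := ∑ p ∈ S ×ˢ S with p.1 - p.2 = δ, g p.1 * g p.2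
    have ex : 3 * f i₀ ^ 2 * g (i₀ - δ) ^ 2 = 3 * x ^ 2 := by rw [hx]; ring
    have ey : 3 * f i₀ ^ 2 * g (i₀ + δ) ^ 2 = 3 * y ^ 2 := by rw [hy]; ring
    rw [ex, ey]
    nlinarith [sq_nonneg (x - y), sq_nonneg (y - z), sq_nonneg (x - z)]
  have h4 := mul_le_mul_of_nonneg_left h1 (by positivity : 0 ≤ 3 * f i₀ ^ 2)
  have h5 := mul_le_mul_of_nonneg_left h2 (by positivity : 0 ≤ 3 * f i₀ ^ 2)
  linarith

/-- Comparison of the `4/3`-norm with the `4/t`-norm, with `f = u ^ 3`. -/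
lemma sum_pow_four_cube_le {n : ℕ} {t : ℝ} (ht : 0 < t) (ht3 : t ≤ 3)
    {u : ℤ → ℝ} (hu : ∀ x, 0 ≤ u x) :
    (∑ a ∈ Finset.Ico (0 : ℤ) n, u a ^ 4) ^ 3 ≤
      (n : ℝ) ^ (3 - t) * (∑ a ∈ Finset.Ico (0 : ℤ) n, u a ^ (12 / t)) ^ t := by
  have h := Real.rpow_sum_le_const_mul_sum_rpow_of_nonneg (Finset.Ico (0 : ℤ) n)
    (f := fun a => u a ^ 4) (p := 3 / t) ((one_le_div ht).2 ht3) (fun i _ => by positivity)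
  have e : ∀ a, (u a ^ 4) ^ (3 / t) = u a ^ (12 / t) := fun a => by
    rw [← Real.rpow_natCast, ← Real.rpow_mul (hu a)]
    congr 1; push_cast; ring
  simp only [e, Int.card_Ico, sub_zero, Int.toNat_natCast] at h
  have h0 : 0 ≤ ∑ a ∈ Finset.Ico (0 : ℤ) n, u a ^ 4 := Finset.sum_nonneg fun i _ => by positivity
  have h1 : 0 ≤ ∑ a ∈ Finset.Ico (0 : ℤ) n, u a ^ (12 / t) :=
    Finset.sum_nonneg fun i _ => Real.rpow_nonneg (hu _) _
  have h2 := Real.rpow_le_rpow (by positivity) h ht.le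
  rw [← Real.rpow_mul h0, div_mul_cancel₀ _ ht.ne', Real.mul_rpow (by positivity) h1,
    ← Real.rpow_mul (by positivity), sub_mul, div_mul_cancel₀ _ ht.ne', one_mul] at h2
  exact_mod_cast h2

/-- Let `Z` be the `12/t`-power sum of `u` off `i₀`. The right side grows linearly in `Z`, with
slope at least `1/2`. The left side exceeds `u i₀ ^ 12` by a small multiple of `Z`: the cross terms
involve `∑ v^6`, of higher degree since `12/t ≤ 5`, and the energy of the remainder is quadratically
small. -/
lemma energyOf_cube_le_of_concentrated {n : ℕ} {t : ℝ} (ht : 8 / 3 ≤ t) (ht3 : t ≤ 3)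
    (hn : (n : ℝ) ^ (3 - t) ≤ 2) {u : ℤ → ℝ} (hu : ∀ x, 0 ≤ u x)
    (hsum : ∑ a ∈ Finset.Ico (0 : ℤ) n, u a ^ 4 = 1) {i₀ : ℤ} (hi : i₀ ∈ Finset.Ico (0 : ℤ) n)
    (hconc : 1 - 1 / 10 ^ 8 < u i₀ ^ 4) :
    energyOf (Finset.Ico (0 : ℤ) n) (fun x => u x ^ 3) ≤
      (∑ a ∈ Finset.Ico (0 : ℤ) n, u a ^ (12 / t)) ^ t := by
  have ht0 : 0 < t := by linarith
  set S := Finset.Ico (0 : ℤ) n with hS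
  set v : ℤ → ℝ := fun x => if x ∈ S ∧ x ≠ i₀ then u x else 0 with hv
  have hv0 : ∀ x, 0 ≤ v x := fun x => by
    have := hu x
    simp only [hv]; split_ifs <;> simp [this]
  have hvi : v i₀ = 0 := by simp [hv]
  have hvu : ∀ x ∈ S.erase i₀, v x = u x := fun x hx => by
    simp [hv, Finset.mem_of_mem_erase hx, Finset.ne_of_mem_erase hx]
  have hq0 : 12 / t ≠ 0 := by positivity
  have hsplit4 : u i₀ ^ 4 + ∑ a ∈ S, v a ^ 4 = 1 := by
    rw [← hsum, ← Finset.add_sum_erase S (fun a => u a ^ 4) hi,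
      ← Finset.add_sum_erase S (fun a => v a ^ 4) hi, hvi]
    rw [Finset.sum_congr rfl fun x hx => by rw [hvu x hx]]
    ring
  set Z := ∑ a ∈ S, v a ^ (12 / t) with hZ
  have hZ0 : 0 ≤ Z := Finset.sum_nonneg fun x _ => Real.rpow_nonneg (hv0 x) _
  have hsplitq : ∑ a ∈ S, u a ^ (12 / t) = u i₀ ^ (12 / t) + Z := by
    rw [hZ, ← Finset.add_sum_erase _ _ hi, ← Finset.add_sum_erase S (fun a => v a ^ (12 / t)) hi,
      hvi, Real.zero_rpow hq0, zero_add]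
    rw [Finset.sum_congr rfl fun x hx => by rw [← hvu x hx]]
  have hρ : ∑ a ∈ S, v a ^ 4 ≤ 1 / 10 ^ 8 := by linarith
  have hρ0 : 0 ≤ ∑ a ∈ S, v a ^ 4 := Finset.sum_nonneg fun i _ => by positivity
  -- The threshold `1 / 10 ^ 8` is the fourth power of `1 / 100`.
  have hvle : ∀ x ∈ S, v x ≤ 1 / 100 := by
    intro x hx
    refine le_of_pow_le_pow_left₀ (n := 4) (by norm_num) (by norm_num) ?_
    calc v x ^ 4 ≤ ∑ a ∈ S, v a ^ 4 :=
          Finset.single_le_sum (f := fun a => v a ^ 4) (fun i _ => by positivity) hx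
      _ ≤ (1 / 100) ^ 4 := by norm_num at hρ ⊢; linarith
  have hq4 : 4 ≤ 12 / t := by rw [le_div_iff₀ ht0]; linarith
  have hq5 : 12 / t ≤ 5 := by rw [div_le_iff₀ ht0]; linarith
  have hZρ : Z ≤ 1 / 10 ^ 8 := by
    refine le_trans (Finset.sum_le_sum fun x hx => ?_) hρ
    have := Real.rpow_le_rpow_of_exponent_ge' (hv0 x) ((hvle x hx).trans (by norm_num))
      (by norm_num : (0 : ℝ) ≤ (4 : ℕ)) (by exact_mod_cast hq4)
    rwa [Real.rpow_natCast] at this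
  have hG : ∑ x ∈ S, (v x ^ 3) ^ 2 ≤ Z / 100 := by
    rw [hZ, Finset.sum_div]
    refine Finset.sum_le_sum fun x hx => ?_
    have h5 := Real.rpow_le_rpow_of_exponent_ge' (hv0 x) ((hvle x hx).trans (by norm_num))
      (by positivity : 0 ≤ 12 / t) (by exact_mod_cast hq5 : 12 / t ≤ (5 : ℕ))
    rw [Real.rpow_natCast] at h5
    have h6 := mul_le_mul_of_nonneg_left (hvle x hx) (by have := hv0 x; positivity : 0 ≤ v x ^ 5)
    calc (v x ^ 3) ^ 2 = v x ^ 5 * v x := by ring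
      _ ≤ v x ^ 5 * (1 / 100) := h6
      _ ≤ _ := by linarith
  have hG0 : 0 ≤ ∑ x ∈ S, (v x ^ 3) ^ 2 := Finset.sum_nonneg fun i _ => by positivity
  have hEv : energyOf S (fun x => v x ^ 3) ≤ Z / 100 := by
    refine (energyOf_cube_le S v).trans ((sum_pow_four_cube_le ht0 ht3 hv0).trans ?_)
    have h2 : Z ^ t ≤ Z ^ (2 : ℕ) := by
      rw [← Real.rpow_natCast]
      exact Real.rpow_le_rpow_of_exponent_ge' hZ0 (hZρ.trans (by norm_num)) (by norm_num)
        (by push_cast; linarith)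
    calc (n : ℝ) ^ (3 - t) * Z ^ t ≤ 2 * Z ^ 2 :=
          mul_le_mul hn h2 (Real.rpow_nonneg hZ0 _) (by norm_num)
      _ ≤ Z / 100 := by norm_num at hZρ; nlinarith
  have hrem := energyOf_le_of_remove_point (f := fun x => u x ^ 3) (g := fun x => v x ^ 3) hi (by
    ext x
    simp only [hv]
    split_ifs <;> simp)
  have hui1 : u i₀ ≤ 1 := by
    refine le_of_pow_le_pow_left₀ (n := 4) (by norm_num) (by norm_num) ?_
    linarith
  have hui0 := hu i₀
  have hx6 : (u i₀ ^ 3) ^ 2 ≤ 1 := by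
    rw [← pow_mul]; exact pow_le_one₀ hui0 hui1
  have hlhs : energyOf S (fun x => u x ^ 3) ≤ u i₀ ^ 12 + Z / 2 := by
    refine hrem.trans ?_
    set G := ∑ x ∈ S, (v x ^ 3) ^ 2
    have e : u i₀ ^ 12 = ((u i₀ ^ 3) ^ 2) ^ 2 := by ring
    rw [e]
    set w := (u i₀ ^ 3) ^ 2
    have hw0 : 0 ≤ w := by positivity
    have hwG : w * G ≤ G := mul_le_of_le_one_left hG0 hx6
    have hG1 : G ≤ 1 := by norm_num at hZρ; linarith
    have hGG : G * G ≤ G := mul_le_of_le_one_left hG0 hG1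
    nlinarith
  have hrhs : u i₀ ^ 12 + Z / 2 ≤ (u i₀ ^ (12 / t) + Z) ^ t := by
    have hupos : 0 < u i₀ := by
      rcases hui0.eq_or_lt with h | h
      · rw [← h] at hconc; norm_num at hconc
      · exact h
    set x := u i₀ ^ (12 / t) with hx
    have hxpos : 0 < x := Real.rpow_pos_of_pos hupos _
    have hxt : x ^ t = u i₀ ^ 12 := by
      rw [hx, ← Real.rpow_mul hui0, div_mul_cancel₀ _ ht0.ne', ← Real.rpow_natCast]; norm_num
    have hx1 : x ≤ 1 := Real.rpow_le_one hui0 hui1 (by positivity)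
    have h12 : 1 / 2 ≤ u i₀ ^ 12 := by
      have : u i₀ ^ 12 = (u i₀ ^ 4) ^ 3 := by ring
      rw [this]
      calc (1 / 2 : ℝ) ≤ (1 - 1 / 10 ^ 8) ^ 3 := by norm_num
        _ ≤ _ := pow_le_pow_left₀ (by norm_num) hconc.le 3
    have hxt1 : 1 / 2 ≤ x ^ (t - 1) := by
      rw [← hxt] at h12
      exact h12.trans (Real.rpow_le_rpow_of_exponent_ge hxpos hx1 (by linarith))
    have hsucc : ∀ y : ℝ, 0 < y → y ^ t = y * y ^ (t - 1) := fun y hy => by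
      rw [Real.rpow_sub_one hy.ne']; field_simp
    rw [hsucc (x + Z) (by linarith), ← hxt, hsucc x hxpos]
    have hmono : x ^ (t - 1) ≤ (x + Z) ^ (t - 1) :=
      Real.rpow_le_rpow hxpos.le (by linarith) (by linarith)
    -- `(x + Z)^t = (x + Z)(x + Z)^(t-1) ≥ x^t + Z x^(t-1)`, where `x^(t-1) ≥ 1/2`.
    nlinarith
  rw [hsplitq]
  exact hlhs.trans hrhs

end Concentrated

/-! ### The one-dimensional inequality for exponents just below 3. -/

section UpperBound

/-- The constant in the upper bound. -/
noncomputable def energyGap : ℝ := (1 / 10 ^ 8) ^ 2 / 1152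

/-- By homogeneity `f` is replaced by `u^3` with `∑ u^4 = 1`, and the proof divides on whether `u^4`
has an atom above `1 - 10^(-8)`. -/
lemma energyOf_le_rpow {n : ℕ} {t : ℝ} (ht : 8 / 3 ≤ t) (ht3 : t ≤ 3)
    (hn : (n : ℝ) ^ (3 - t) ≤ 1 + energyGap) (f : ℤ → ℝ) (hf : ∀ x, 0 ≤ f x) :
    energyOf (Finset.Ico (0 : ℤ) n) f ≤ (∑ i ∈ Finset.Ico (0 : ℤ) n, f i ^ (4 / t)) ^ t := by
  have ht0 : 0 < t := by linarith
  set S := Finset.Ico (0 : ℤ) n with hS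
  set V := ∑ a ∈ S, f a ^ (4 / 3 : ℝ) with hV
  have hV0 : 0 ≤ V := Finset.sum_nonneg fun x _ => Real.rpow_nonneg (hf x) _
  have hq : 4 / t ≠ 0 := by positivity
  rcases hV0.eq_or_lt with hV0 | hVpos
  · have hz : ∀ x ∈ S, f x = 0 := fun x hx => by
      have := (Finset.sum_eq_zero_iff_of_nonneg fun x _ => Real.rpow_nonneg (hf x) _).1
        hV0.symm x hx
      exact ((Real.rpow_eq_zero_iff_of_nonneg (hf x)).1 this).1
    have e : energyOf S f = 0 := by
      have h := energyOf_smul S 0 f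
      rw [← energyOf_congr (f := f)] at h
      · simpa using h
      · intro x hx; simp [hz x hx]
    rw [e]
    exact Real.rpow_nonneg (Finset.sum_nonneg fun x _ => Real.rpow_nonneg (hf x) _) _
  set c := V ^ (3 / 4 : ℝ) with hc
  have hcpos : 0 < c := Real.rpow_pos_of_pos hVpos _
  set u : ℤ → ℝ := fun x => (f x / c) ^ (1 / 3 : ℝ) with hu
  have hfc : ∀ x, 0 ≤ f x / c := fun x => div_nonneg (hf x) hcpos.le
  have hu0 : ∀ x, 0 ≤ u x := fun x => Real.rpow_nonneg (hfc x) _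
  have hu3 : ∀ x, u x ^ 3 = f x / c := fun x => by
    rw [hu, ← Real.rpow_natCast, ← Real.rpow_mul (hfc x)]; norm_num
  have hur : ∀ x (s : ℝ), u x ^ s = f x ^ (s / 3) / c ^ (s / 3) := fun x s => by
    rw [hu, ← Real.rpow_mul (hfc x), Real.div_rpow (hf x) hcpos.le]
    ring_nf
  have hc43 : c ^ (4 / 3 : ℝ) = V := by
    rw [hc, ← Real.rpow_mul hVpos.le]; norm_num
  have hsum : ∑ a ∈ S, u a ^ 4 = 1 := by
    have : ∀ a, u a ^ 4 = f a ^ (4 / 3 : ℝ) / V := fun a => by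
      rw [← hc43, ← hur]; norm_cast
    simp only [this]
    rw [← Finset.sum_div, ← hV, div_self hVpos.ne']
  have hE : energyOf S f = c ^ 4 * energyOf S (fun x => u x ^ 3) := by
    rw [← energyOf_smul]
    refine energyOf_congr fun x _ => ?_
    rw [hu3]; field_simp
  have hN : (∑ i ∈ S, f i ^ (4 / t)) ^ t = c ^ 4 * (∑ a ∈ S, u a ^ (12 / t)) ^ t := by
    have e : ∀ a, u a ^ (12 / t) = f a ^ (4 / t) / c ^ (4 / t) := fun a => by
      rw [hur]; congr 2 <;> ring
    simp only [e]
    rw [← Finset.sum_div, Real.div_rpow (Finset.sum_nonneg fun x _ => Real.rpow_nonneg (hf x) _)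
      (Real.rpow_nonneg hcpos.le _), ← Real.rpow_mul hcpos.le, div_mul_cancel₀ _ ht0.ne']
    have : c ^ (4 : ℝ) = c ^ 4 := by norm_cast
    rw [this]; field_simp
  rw [hE, hN]
  refine mul_le_mul_of_nonneg_left ?_ (by positivity)
  by_cases hconc : ∀ a ∈ S, u a ^ 4 ≤ 1 - 1 / 10 ^ 8
  · have h1 := energyOf_cube_le_of_not_concentrated (by norm_num) hsum hconc
    have h2 := sum_pow_four_cube_le (n := n) ht0 ht3 hu0
    rw [hsum, one_pow] at h2
    set Y := (∑ a ∈ S, u a ^ (12 / t)) ^ t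
    have hY0 : 0 ≤ Y := Real.rpow_nonneg
      (Finset.sum_nonneg fun x _ => Real.rpow_nonneg (hu0 x) _) _
    have h3 : 1 ≤ (1 + energyGap) * Y := h2.trans (mul_le_mul_of_nonneg_right hn hY0)
    rw [energyGap] at h3
    norm_num at h1 h3
    -- The stability gain outweighs the Hölder loss, as `(1 - energyGap) (1 + energyGap) ≤ 1`.
    nlinarith
  · push Not at hconc
    obtain ⟨i₀, hi, hlt⟩ := hconc
    refine energyOf_cube_le_of_concentrated ht ht3 (hn.trans ?_) hu0 hsum hi hlt
    rw [energyGap]; norm_num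

end UpperBound

/-! ### Existence of the least exponent, its upper bound, and test functions. -/

section MinEnergyExponent

lemma energyGap_pos : 0 < energyGap := by unfold energyGap; positivity

lemma three_sub_logb_mem_energyExponents {n : ℕ} (hn : 2 ≤ n) :
    3 - Real.logb n (1 + energyGap) ∈ energyExponents n := by
  have hn1 : (1 : ℝ) < n := by exact_mod_cast hn
  have hc := energyGap_pos
  have h0 : 0 ≤ Real.logb n (1 + energyGap) := Real.logb_nonneg hn1 (by linarith)
  have h13 : Real.logb n (1 + energyGap) ≤ 1 / 3 := by
    rw [Real.logb_le_iff_le_rpow hn1 (by linarith)]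
    have h2 : (2 : ℝ) ^ (1 / 3 : ℝ) ≤ (n : ℝ) ^ (1 / 3 : ℝ) :=
      Real.rpow_le_rpow (by norm_num) (by exact_mod_cast hn) (by norm_num)
    refine le_trans ?_ h2
    refine le_of_pow_le_pow_left₀ (n := 3) (by norm_num) (by positivity) ?_
    rw [← Real.rpow_natCast ((2 : ℝ) ^ (1 / 3 : ℝ)), ← Real.rpow_mul (by norm_num)]
    norm_num [energyGap]
  have ht : 8 / 3 ≤ 3 - Real.logb n (1 + energyGap) := by linarith
  refine mem_energyExponents_of_energyOf_le (by linarith) ?_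
  refine energyOf_le_rpow ht (by linarith) ?_
  rw [sub_sub_cancel, Real.rpow_logb (by linarith) hn1.ne' (by linarith)]

lemma two_le_of_mem_energyExponents {n : ℕ} (hn : 2 ≤ n) {t : ℝ} (ht : t ∈ energyExponents n) :
    2 ≤ t := by
  set A : Finset (Fin 1 → ℤ) := {fun _ => 0, fun _ => 1} with hA
  have hcard : A.card = 2 := Finset.card_pair fun h => by simpa using congrFun h 0
  have h := ht 1 one_pos A (by
    intro x hx
    rw [mem_discreteCube]
    intro i
    rw [hA, Finset.mem_insert, Finset.mem_singleton] at hx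
    rw [Finset.mem_Ico]
    rcases hx with rfl | rfl <;> constructor <;> norm_num <;> omega)
  have h2 : (4 : ℝ) ≤ Finset.addEnergy A A := by
    have := Finset.le_addEnergy (s := A) (t := A)
    rw [hcard] at this
    exact_mod_cast this
  rw [hcard] at h
  have h3 : (2 : ℝ) ^ (2 : ℝ) ≤ (2 : ℝ) ^ t := by
    have h4 := h2.trans h
    norm_num at h4 ⊢
    exact h4
  exact (Real.rpow_le_rpow_left_iff (by norm_num)).1 h3

lemma bddBelow_energyExponents {n : ℕ} (hn : 2 ≤ n) : BddBelow (energyExponents n) :=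
  ⟨2, fun _ ht => two_le_of_mem_energyExponents hn ht⟩

/-- Each set `A` imposes a closed condition on `t`: for nonempty `A` by continuity of `t ↦ |A|^t`,
for the empty set because the condition is void. Hence the infimum is attained. -/
lemma isClosed_energyExponents (n : ℕ) : IsClosed (energyExponents n) := by
  have e : energyExponents n = ⋂ (d : ℕ) (_ : 0 < d) (A : Finset (Fin d → ℤ))
      (_ : A ⊆ discreteCube n d), {t : ℝ | (Finset.addEnergy A A : ℝ) ≤ (A.card : ℝ) ^ t} := by
    ext t; simp [energyExponents]
  rw [e]
  refine isClosed_iInter fun d => isClosed_iInter fun _ => isClosed_iInter fun A =>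
    isClosed_iInter fun _ => ?_
  rcases A.eq_empty_or_nonempty with rfl | hA
  · convert! isClosed_univ
    ext t
    simp [Real.rpow_nonneg]
  · have : (A.card : ℝ) ≠ 0 := by exact_mod_cast hA.card_pos.ne'
    exact isClosed_le continuous_const (Real.continuous_const_rpow this)

lemma isLeast_minEnergyExponent {n : ℕ} (hn : 2 ≤ n) :
    IsLeast (energyExponents n) (minEnergyExponent n) :=
  (isClosed_energyExponents n).isLeast_csInf ⟨_, three_sub_logb_mem_energyExponents hn⟩
    (bddBelow_energyExponents hn)

lemma minEnergyExponent_le {n : ℕ} (hn : 2 ≤ n) :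
    minEnergyExponent n ≤ 3 - Real.logb n (1 + energyGap) :=
  csInf_le (bddBelow_energyExponents hn) (three_sub_logb_mem_energyExponents hn)

lemma minEnergyExponent_le_three {n : ℕ} (hn : 2 ≤ n) : minEnergyExponent n ≤ 3 := by
  have h0 : 0 ≤ Real.logb n (1 + energyGap) :=
    Real.logb_nonneg (by exact_mod_cast hn) (by linarith [energyGap_pos])
  linarith [minEnergyExponent_le hn]

/-- A test function `f` gives a lower bound for `t_n`. -/
lemma three_sub_mul_log_le {n : ℕ} (hn : 2 ≤ n) {f : ℤ → ℝ} (hf : ∀ x, 0 < f x)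
    (hf1 : ∀ x, f x ≤ 1) {E W : ℝ} (hE : 0 < E)
    (hEf : E ≤ energyOf (Finset.Ico (0 : ℤ) n) f)
    (hW : ∑ i ∈ Finset.Ico (0 : ℤ) n, f i ^ (4 / 3 : ℝ) ≤ W) :
    (3 - minEnergyExponent n) * Real.log W ≤ Real.log (W ^ 3 / E) := by
  have hmem := (isLeast_minEnergyExponent hn).1
  have ht2 := two_le_of_mem_energyExponents hn hmem
  have ht3 := minEnergyExponent_le_three hn
  set t := minEnergyExponent n
  have ht0 : 0 < t := by linarith
  have h1 := energyOf_le_of_mem_energyExponents ht0 hmem f fun x => (hf x).le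
  -- Since `f ≤ 1` and `4 / t ≥ 4 / 3`, the unknown exponent can be replaced by `4 / 3`.
  have h2 : ∑ i ∈ Finset.Ico (0 : ℤ) n, f i ^ (4 / t) ≤ W :=
    (Finset.sum_le_sum fun i _ => Real.rpow_le_rpow_of_exponent_ge (hf i) (hf1 i)
      (div_le_div_of_nonneg_left (by norm_num) ht0 ht3)).trans hW
  have hW0 : 0 < W := by
    refine lt_of_lt_of_le (Finset.sum_pos (fun i _ => Real.rpow_pos_of_pos (hf i) _) ?_) hW
    exact ⟨0, Finset.mem_Ico.2 ⟨le_rfl, by omega⟩⟩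
  have h3 : E ≤ W ^ t := hEf.trans (h1.trans (Real.rpow_le_rpow
    (Finset.sum_nonneg fun i _ => Real.rpow_nonneg (hf i).le _) h2 ht0.le))
  have h4 := Real.log_le_log hE h3
  rw [Real.log_rpow hW0] at h4
  rw [Real.log_div (by positivity) hE.ne', Real.log_pow]
  push_cast
  linarith

end MinEnergyExponent

/-! ### Discrete Gaussian sums and the energy of a Gaussian. -/

section Gaussian

/-- One half of a Gaussian sum, without the central term. -/
noncomputable def halfGaussSum (b : ℝ) (R : ℕ) : ℝ :=
  ∑ r ∈ Finset.range R, Real.exp (-(b * (r + 1)) ^ 2)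

lemma halfGaussSum_nonneg (b : ℝ) (R : ℕ) : 0 ≤ halfGaussSum b R :=
  Finset.sum_nonneg fun _ _ => (Real.exp_pos _).le

lemma antitoneOn_gaussian (b : ℝ) {c : ℝ} :
    AntitoneOn (fun x : ℝ => Real.exp (-(b * x) ^ 2)) (Set.Icc 0 c) := by
  intro x hx y hy hxy
  refine Real.exp_le_exp.2 (neg_le_neg ?_)
  rw [mul_pow, mul_pow]
  exact mul_le_mul_of_nonneg_left (pow_le_pow_left₀ hx.1 hxy 2) (sq_nonneg b)

lemma mul_integral_gaussian (b c : ℝ) :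
    b * ∫ x in (0 : ℝ)..c, Real.exp (-(b * x) ^ 2) = ∫ x in (0 : ℝ)..b * c, Real.exp (-x ^ 2) := by
  have := intervalIntegral.mul_integral_comp_mul_left (a := 0) (b := c)
    (f := fun x : ℝ => Real.exp (-x ^ 2)) b
  simpa using this

lemma mul_halfGaussSum_le {b : ℝ} (hb : 0 ≤ b) (R : ℕ) :
    b * halfGaussSum b R ≤ ∫ x in (0 : ℝ)..b * R, Real.exp (-x ^ 2) := by
  rw [← mul_integral_gaussian]
  refine mul_le_mul_of_nonneg_left ?_ hb
  have := AntitoneOn.sum_le_integral (x₀ := 0) (a := R) (f := fun x : ℝ => Real.exp (-(b * x) ^ 2))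
    (antitoneOn_gaussian b)
  simpa [halfGaussSum] using this

lemma le_mul_halfGaussSum {b : ℝ} (hb : 0 ≤ b) (R : ℕ) :
    (∫ x in (0 : ℝ)..b * R, Real.exp (-x ^ 2)) - b ≤ b * halfGaussSum b R := by
  rw [← mul_integral_gaussian]
  have := AntitoneOn.integral_le_sum (x₀ := 0) (a := R) (f := fun x : ℝ => Real.exp (-(b * x) ^ 2))
    (antitoneOn_gaussian b)
  simp only [zero_add] at this
  -- The sum bounding the integral starts at the centre, which `halfGaussSum` omits; this is the
  -- source of the error `b`.
  have h2 : ∑ i ∈ Finset.range R, Real.exp (-(b * i) ^ 2) ≤ halfGaussSum b R + 1 := by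
    calc _ ≤ ∑ i ∈ Finset.range (R + 1), Real.exp (-(b * i) ^ 2) :=
          Finset.sum_le_sum_of_subset_of_nonneg (Finset.range_mono (Nat.le_succ R))
            fun _ _ _ => (Real.exp_pos _).le
      _ = _ := by rw [Finset.sum_range_succ']; simp [halfGaussSum]
  nlinarith [mul_le_mul_of_nonneg_left (this.trans h2) hb]

lemma tendsto_mul_halfGaussSum {b : ℕ → ℝ} {R : ℕ → ℕ} (hb : ∀ n, 0 ≤ b n)
    (hb0 : Tendsto b atTop (𝓝 0)) (hR : Tendsto (fun n => b n * R n) atTop atTop) :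
    Tendsto (fun n => b n * halfGaussSum (b n) (R n)) atTop (𝓝 (√Real.pi / 2)) := by
  have hint : Tendsto (fun n => ∫ x in (0 : ℝ)..b n * R n, Real.exp (-x ^ 2)) atTop
      (𝓝 (√Real.pi / 2)) := by
    have h1 := integral_gaussian_Ioi 1
    have h2 : MeasureTheory.IntegrableOn (fun x : ℝ => Real.exp (-1 * x ^ 2)) (Set.Ioi 0) :=
      (integrable_exp_neg_mul_sq one_pos).integrableOn
    have h3 := MeasureTheory.intervalIntegral_tendsto_integral_Ioi 0 h2 hR
    rw [h1, div_one] at h3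
    simpa using h3
  have hlow : Tendsto (fun n => (∫ x in (0 : ℝ)..b n * R n, Real.exp (-x ^ 2)) - b n) atTop
      (𝓝 (√Real.pi / 2)) := by simpa using hint.sub hb0
  refine tendsto_of_tendsto_of_tendsto_of_le_of_le' hlow hint ?_ ?_
  · exact Eventually.of_forall fun n => le_mul_halfGaussSum (hb n) _
  · exact Eventually.of_forall fun n => mul_halfGaussSum_le (hb n) _

lemma sum_gaussian_le (b : ℝ) {m n : ℕ} (hm : m < n) :
    ∑ i ∈ Finset.Ico (0 : ℤ) n, Real.exp (-(b * ((i : ℝ) - m)) ^ 2) ≤ 1 + 2 * halfGaussSum b n := by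
  set h : ℤ → ℝ := fun i => Real.exp (-(b * ((i : ℝ) - m)) ^ 2) with hh
  have hpos : ∀ i, 0 ≤ h i := fun i => (Real.exp_pos _).le
  set A := (Finset.range n).image (fun r : ℕ => (m : ℤ) + (r + 1)) with hA
  set B := (Finset.range n).image (fun r : ℕ => (m : ℤ) - (r + 1)) with hB
  have hsA : ∑ i ∈ A, h i = halfGaussSum b n := by
    rw [hA, Finset.sum_image fun a _ c _ hac => by simpa using hac]
    refine Finset.sum_congr rfl fun r _ => ?_
    simp only [hh]; push_cast; congr 1; ring
  have hsB : ∑ i ∈ B, h i = halfGaussSum b n := by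
    rw [hB, Finset.sum_image fun a _ c _ hac => by simpa using hac]
    refine Finset.sum_congr rfl fun r _ => ?_
    simp only [hh]; push_cast; congr 1; ring
  have hm1 : ∑ i ∈ {(m : ℤ)}, h i = 1 := by simp [hh]
  have hsub : Finset.Ico (0 : ℤ) n ⊆ {(m : ℤ)} ∪ (A ∪ B) := by
    intro i hi
    rw [Finset.mem_Ico] at hi
    simp only [Finset.mem_union, Finset.mem_singleton, hA, hB, Finset.mem_image, Finset.mem_range]
    rcases lt_trichotomy i m with h1 | h1 | h1
    · exact Or.inr (Or.inr ⟨(m - 1 - i).toNat, by omega, by omega⟩)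
    · exact Or.inl h1
    · exact Or.inr (Or.inl ⟨(i - m - 1).toNat, by omega, by omega⟩)
  have hun : ∀ C D : Finset ℤ, ∑ i ∈ C ∪ D, h i ≤ ∑ i ∈ C, h i + ∑ i ∈ D, h i := fun C D => by
    rw [← Finset.sum_union_inter]
    linarith [Finset.sum_nonneg fun i (_ : i ∈ C ∩ D) => hpos i]
  calc _ ≤ ∑ i ∈ {(m : ℤ)} ∪ (A ∪ B), h i :=
        Finset.sum_le_sum_of_subset_of_nonneg hsub fun i _ _ => hpos i
    _ ≤ ∑ i ∈ {(m : ℤ)}, h i + (∑ i ∈ A, h i + ∑ i ∈ B, h i) :=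
        (hun _ _).trans (by linarith [hun A B])
    _ = _ := by rw [hsA, hsB, hm1]; ring

lemma le_sum_gaussian_Icc (b : ℝ) (m : ℕ) :
    2 * halfGaussSum b m ≤ ∑ δ ∈ Finset.Icc (-(m : ℤ)) m, Real.exp (-(b * δ) ^ 2) := by
  set h : ℤ → ℝ := fun i => Real.exp (-(b * i) ^ 2) with hh
  set A := (Finset.range m).image (fun r : ℕ => ((r : ℤ) + 1)) with hA
  set B := (Finset.range m).image (fun r : ℕ => -((r : ℤ) + 1)) with hB
  have hsA : ∑ i ∈ A, h i = halfGaussSum b m := by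
    rw [hA, Finset.sum_image fun a _ c _ hac => by simpa using hac]
    refine Finset.sum_congr rfl fun r _ => ?_
    simp only [hh]; push_cast; rfl
  have hsB : ∑ i ∈ B, h i = halfGaussSum b m := by
    rw [hB, Finset.sum_image fun a _ c _ hac => by simpa using hac]
    refine Finset.sum_congr rfl fun r _ => ?_
    simp only [hh]; push_cast; congr 1; ring
  have hdis : Disjoint A B := by
    rw [Finset.disjoint_left]
    intro i hi hj
    obtain ⟨r, -, rfl⟩ := Finset.mem_image.1 hi
    obtain ⟨r', -, h'⟩ := Finset.mem_image.1 hj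
    omega
  calc 2 * halfGaussSum b m = ∑ i ∈ A ∪ B, h i := by rw [Finset.sum_union hdis, hsA, hsB]; ring
    _ ≤ _ := by
      refine Finset.sum_le_sum_of_subset_of_nonneg ?_ fun i _ _ => (Real.exp_pos _).le
      intro i hi
      rw [Finset.mem_Icc]
      rcases Finset.mem_union.1 hi with hi | hi <;>
      · obtain ⟨r, hr, rfl⟩ := Finset.mem_image.1 hi
        rw [Finset.mem_range] at hr
        omega

/-- By `(a + δ)^2 + a^2 = 2 (a + δ/2)^2 + δ^2/2`, the product is a Gaussian in `δ` times one in `a`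
centred at `-δ/2`. Keeping `a` within `m/2` of the centre keeps both points in the window. -/
lemma le_gaussian_autocorrelation (s : ℝ) {m n : ℕ} (hmn : 2 * m < n) {δ : ℤ}
    (hδ : δ ∈ Finset.Icc (-(m : ℤ)) m) :
    Real.exp (-(s ^ 2 * δ ^ 2 / 2)) * (2 * halfGaussSum (√2 * s) (m / 2)) ≤
      ∑ p ∈ Finset.Ico (0 : ℤ) n ×ˢ Finset.Ico (0 : ℤ) n with p.1 - p.2 = δ,
        Real.exp (-(s * ((p.1 : ℝ) - m)) ^ 2) * Real.exp (-(s * ((p.2 : ℝ) - m)) ^ 2) := by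
  rw [Finset.mem_Icc] at hδ
  -- `k` is the floor of the centre `-δ/2`: the points `k + 1 + r` above it and `k - r` below it lie
  -- within `r + 1` of it, whatever the parity of `δ`.
  obtain ⟨k, hk1, hk2⟩ : ∃ k : ℤ, 2 * k ≤ -δ ∧ -δ ≤ 2 * k + 1 := ⟨(-δ) / 2, by omega, by omega⟩
  set H : ℤ × ℤ → ℝ := fun p =>
    Real.exp (-(s * ((p.1 : ℝ) - m)) ^ 2) * Real.exp (-(s * ((p.2 : ℝ) - m)) ^ 2) with hH
  set φ : ℕ → ℤ × ℤ := fun r => (m + (k + 1 + r) + δ, m + (k + 1 + r)) with hφ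
  set ψ : ℕ → ℤ × ℤ := fun r => (m + (k - r) + δ, m + (k - r)) with hψ
  have hterm : ∀ (r : ℕ) (a : ℤ), |(a : ℝ) + δ / 2| ≤ r + 1 →
      Real.exp (-(s ^ 2 * δ ^ 2 / 2)) * Real.exp (-(√2 * s * (r + 1)) ^ 2) ≤
        H (m + a + δ, m + a) := by
    intro r a hr
    simp only [hH]
    rw [← Real.exp_add, ← Real.exp_add]
    refine Real.exp_le_exp.2 ?_
    have h1 := sq_le_sq' (abs_le.1 hr).1 (abs_le.1 hr).2
    have h2 := mul_le_mul_of_nonneg_left h1 (sq_nonneg s)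
    have e : (√2 * s * (r + 1)) ^ 2 = 2 * (s ^ 2 * ((r : ℝ) + 1) ^ 2) := by
      rw [mul_pow, mul_pow, Real.sq_sqrt (by norm_num)]; ring
    rw [e]
    push_cast
    nlinarith
  have hk1' : 2 * (k : ℝ) ≤ -δ := by exact_mod_cast hk1
  have hk2' : -(δ : ℝ) ≤ 2 * k + 1 := by exact_mod_cast hk2
  have hφi : Function.Injective φ := fun a b h => by
    have := congrArg Prod.snd h
    simpa [hφ] using this
  have hψi : Function.Injective ψ := fun a b h => by
    have := congrArg Prod.snd h
    simpa [hψ] using this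
  have hdis : Disjoint ((Finset.range (m / 2)).image φ) ((Finset.range (m / 2)).image ψ) := by
    rw [Finset.disjoint_left]
    intro p hp hq
    obtain ⟨r, -, rfl⟩ := Finset.mem_image.1 hp
    obtain ⟨r', -, h'⟩ := Finset.mem_image.1 hq
    have := congrArg Prod.snd h'
    simp only [hφ, hψ] at this
    omega
  calc _ = ∑ r ∈ Finset.range (m / 2),
          Real.exp (-(s ^ 2 * δ ^ 2 / 2)) * Real.exp (-(√2 * s * (r + 1)) ^ 2) +
        ∑ r ∈ Finset.range (m / 2),
          Real.exp (-(s ^ 2 * δ ^ 2 / 2)) * Real.exp (-(√2 * s * (r + 1)) ^ 2) := by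
        rw [← Finset.mul_sum, halfGaussSum]; ring
    _ ≤ ∑ r ∈ Finset.range (m / 2), H (φ r) + ∑ r ∈ Finset.range (m / 2), H (ψ r) := by
        refine add_le_add (Finset.sum_le_sum fun r _ => hterm r _ ?_)
          (Finset.sum_le_sum fun r _ => hterm r _ ?_)
        · have : (0 : ℝ) ≤ r := r.cast_nonneg
          push_cast
          rw [abs_le]; constructor <;> linarith
        · have : (0 : ℝ) ≤ r := r.cast_nonneg
          push_cast
          rw [abs_le]; constructor <;> linarith
    _ = ∑ p ∈ (Finset.range (m / 2)).image φ ∪ (Finset.range (m / 2)).image ψ, H p := by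
        rw [Finset.sum_union hdis, Finset.sum_image hφi.injOn, Finset.sum_image hψi.injOn]
    _ ≤ _ := by
        refine Finset.sum_le_sum_of_subset_of_nonneg ?_ fun p _ _ => by
          simp only [hH]; positivity
        intro p hp
        rcases Finset.mem_union.1 hp with hp | hp <;>
        · obtain ⟨r, hr, rfl⟩ := Finset.mem_image.1 hp
          rw [Finset.mem_range] at hr
          simp only [hφ, hψ, Finset.mem_filter, Finset.mem_product, Finset.mem_Ico]
          omega

lemma le_energyOf_gaussian (s : ℝ) {m n : ℕ} (hmn : 2 * m < n) :
    2 * halfGaussSum s m * (2 * halfGaussSum (√2 * s) (m / 2)) ^ 2 ≤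
      energyOf (Finset.Ico (0 : ℤ) n) (fun i => Real.exp (-(s * ((i : ℝ) - m)) ^ 2)) := by
  rw [energyOf_eq_sum_sq]
  set Gi := 2 * halfGaussSum (√2 * s) (m / 2) with hGi
  have hGi0 : 0 ≤ Gi := mul_nonneg zero_le_two (halfGaussSum_nonneg _ _)
  have hsub : Finset.Icc (-(m : ℤ)) m ⊆
      (Finset.Ico (0 : ℤ) n ×ˢ Finset.Ico (0 : ℤ) n).image (fun p => p.1 - p.2) := by
    intro δ hδ
    rw [Finset.mem_Icc] at hδ
    refine Finset.mem_image.2 ⟨(m + δ, m), ?_, by simp⟩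
    simp only [Finset.mem_product, Finset.mem_Ico]
    omega
  calc 2 * halfGaussSum s m * Gi ^ 2
      ≤ (∑ δ ∈ Finset.Icc (-(m : ℤ)) m, Real.exp (-(s * δ) ^ 2)) * Gi ^ 2 :=
        mul_le_mul_of_nonneg_right (le_sum_gaussian_Icc s m) (sq_nonneg _)
    _ = ∑ δ ∈ Finset.Icc (-(m : ℤ)) m, (Real.exp (-(s ^ 2 * δ ^ 2 / 2)) * Gi) ^ 2 := by
        rw [Finset.sum_mul]
        refine Finset.sum_congr rfl fun δ _ => ?_
        rw [mul_pow (Real.exp _) Gi, ← Real.exp_nat_mul]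
        congr 2
        push_cast; ring
    _ ≤ ∑ δ ∈ Finset.Icc (-(m : ℤ)) m,
          (∑ p ∈ Finset.Ico (0 : ℤ) n ×ˢ Finset.Ico (0 : ℤ) n with p.1 - p.2 = δ,
            Real.exp (-(s * ((p.1 : ℝ) - m)) ^ 2) * Real.exp (-(s * ((p.2 : ℝ) - m)) ^ 2)) ^ 2 :=
        Finset.sum_le_sum fun δ hδ => pow_le_pow_left₀ (mul_nonneg (Real.exp_pos _).le hGi0)
          (le_gaussian_autocorrelation s hmn hδ) 2
    _ ≤ _ := Finset.sum_le_sum_of_subset_of_nonneg hsub fun _ _ _ => sq_nonneg _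

lemma sum_gaussian_rpow_le (s : ℝ) {m n : ℕ} (hm : m < n) :
    ∑ i ∈ Finset.Ico (0 : ℤ) n, Real.exp (-(s * ((i : ℝ) - m)) ^ 2) ^ (4 / 3 : ℝ) ≤
      1 + 2 * halfGaussSum (2 / √3 * s) n := by
  refine le_of_eq_of_le (Finset.sum_congr rfl fun i _ => ?_) (sum_gaussian_le (2 / √3 * s) hm)
  rw [← Real.exp_mul]
  congr 1
  have h3 : √3 ^ 2 = 3 := Real.sq_sqrt (by norm_num)
  rw [mul_pow, mul_pow, mul_pow, div_pow, h3]
  ring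

end Gaussian

/-! ### Asymptotics of the Gaussian test function and the lower bound. -/

section LowerBound

/-- The inverse width of the Gaussian test function on `{0, …, n - 1}`. -/
noncomputable def gaussScale (n : ℕ) : ℝ := Real.log n / n

/-- A lower bound for the energy of the Gaussian test function. -/
noncomputable def gaussEnergy (n : ℕ) : ℝ :=
  2 * halfGaussSum (gaussScale n) ((n - 1) / 2) *
    (2 * halfGaussSum (√2 * gaussScale n) ((n - 1) / 2 / 2)) ^ 2

/-- An upper bound for the mass of the Gaussian test function. -/
noncomputable def gaussMass (n : ℕ) : ℝ := 1 + 2 * halfGaussSum (2 / √3 * gaussScale n) n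

lemma tendsto_gaussScale : Tendsto gaussScale atTop (𝓝 0) := by
  have h := Real.isLittleO_log_id_atTop.tendsto_div_nhds_zero.comp tendsto_natCast_atTop_atTop
  exact h

lemma tendsto_log_natCast : Tendsto (fun n : ℕ => Real.log n) atTop atTop :=
  Real.tendsto_log_atTop.comp tendsto_natCast_atTop_atTop

lemma gaussScale_nonneg (n : ℕ) : 0 ≤ gaussScale n :=
  div_nonneg (Real.log_natCast_nonneg n) n.cast_nonneg

/-- The logarithm in the scale serves here: the window covers about `log n` widths, so truncation is
harmless, while the scale still tends to 0. -/
lemma tendsto_mul_gaussScale_mul {c : ℝ} (hc : 0 < c) {R : ℕ → ℕ} (k : ℕ)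
    (hR : ∀ᶠ n : ℕ in atTop, n ≤ k * R n) :
    Tendsto (fun n => c * gaussScale n * R n) atTop atTop := by
  have h1 : Tendsto (fun n : ℕ => c / (k + 1) * Real.log n) atTop atTop :=
    tendsto_log_natCast.const_mul_atTop (by positivity)
  refine tendsto_atTop_mono' _ ?_ h1
  filter_upwards [hR, eventually_gt_atTop 0] with n hn hn0
  have hn' : (n : ℝ) ≤ k * R n := by exact_mod_cast hn
  have hn0' : (0 : ℝ) < n := by exact_mod_cast hn0
  have hl := Real.log_natCast_nonneg n
  have hRn : (0 : ℝ) ≤ R n := Nat.cast_nonneg _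
  have hk : (n : ℝ) / (k + 1) ≤ R n := by
    rw [div_le_iff₀ (by positivity)]; nlinarith
  calc c / (k + 1) * Real.log n = c * gaussScale n * (n / (k + 1)) := by
        rw [gaussScale]; field_simp
    _ ≤ _ := mul_le_mul_of_nonneg_left hk (mul_nonneg hc.le (gaussScale_nonneg n))

lemma tendsto_gaussScale_mul_halfGaussSum {c : ℝ} (hc : 0 < c) {R : ℕ → ℕ} (k : ℕ)
    (hR : ∀ᶠ n : ℕ in atTop, n ≤ k * R n) :
    Tendsto (fun n => gaussScale n * halfGaussSum (c * gaussScale n) (R n)) atTop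
      (𝓝 (√Real.pi / 2 / c)) := by
  have h := tendsto_mul_halfGaussSum (b := fun n => c * gaussScale n) (R := R)
    (fun n => mul_nonneg hc.le (gaussScale_nonneg n))
    (by simpa using tendsto_gaussScale.const_mul c) (tendsto_mul_gaussScale_mul hc k hR)
  refine (h.div_const c).congr fun n => ?_
  field_simp

lemma tendsto_gaussScale_mul_gaussMass :
    Tendsto (fun n => gaussScale n * gaussMass n) atTop (𝓝 (√3 * √Real.pi / 2)) := by
  have h := tendsto_gaussScale_mul_halfGaussSum (c := 2 / √3) (by positivity) (R := fun n => n) 1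
    (Eventually.of_forall fun n => by simp)
  have h2 := tendsto_gaussScale.add (h.const_mul 2)
  have e : 0 + 2 * (√Real.pi / 2 / (2 / √3)) = √3 * √Real.pi / 2 := by field_simp; ring
  rw [e] at h2
  refine h2.congr fun n => ?_
  rw [gaussMass]; ring

lemma tendsto_gaussScale_mul_gaussEnergy :
    Tendsto (fun n => gaussScale n ^ 3 * gaussEnergy n) atTop (𝓝 (√Real.pi ^ 3 / 2)) := by
  have h1 := tendsto_gaussScale_mul_halfGaussSum (c := 1) one_pos (R := fun n => (n - 1) / 2) 6
    (by filter_upwards [eventually_ge_atTop 8] with n hn; omega)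
  have h2 := tendsto_gaussScale_mul_halfGaussSum (c := √2) (by positivity)
    (R := fun n => (n - 1) / 2 / 2) 12
    (by filter_upwards [eventually_ge_atTop 16] with n hn; omega)
  have h3 := (h1.const_mul 2).mul ((h2.const_mul 2).pow 2)
  have e : 2 * (√Real.pi / 2 / 1) * (2 * (√Real.pi / 2 / √2)) ^ 2 = √Real.pi ^ 3 / 2 := by
    have : √2 ^ 2 = 2 := Real.sq_sqrt (by norm_num)
    field_simp
    rw [this]
  rw [e] at h3
  refine h3.congr fun n => ?_
  rw [gaussEnergy, one_mul]; ring

lemma eventually_gaussScale_pos : ∀ᶠ n : ℕ in atTop, 0 < gaussScale n := by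
  filter_upwards [eventually_ge_atTop 2] with n hn
  have h1 : (1 : ℝ) < n := by exact_mod_cast hn
  exact div_pos (Real.log_pos h1) (by linarith)

/-- Mass grows like `1/s` and energy like `1/s^3` in the scale `s`, so the scale cancels and only
the ratio of Gaussian integrals remains. -/
lemma tendsto_gaussMass_pow_div_gaussEnergy :
    Tendsto (fun n => gaussMass n ^ 3 / gaussEnergy n) atTop (𝓝 (3 * √3 / 4)) := by
  have hπ : 0 < √Real.pi := Real.sqrt_pos.2 Real.pi_pos
  have h := (tendsto_gaussScale_mul_gaussMass.pow 3).div tendsto_gaussScale_mul_gaussEnergy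
    (by positivity)
  have e : (√3 * √Real.pi / 2) ^ 3 / (√Real.pi ^ 3 / 2) = 3 * √3 / 4 := by
    have : √3 ^ 3 = 3 * √3 := by
      rw [pow_succ, Real.sq_sqrt (by norm_num)]
    rw [div_pow, mul_pow, this]
    field_simp
    norm_num
  rw [e] at h
  refine h.congr' ?_
  filter_upwards [eventually_gaussScale_pos] with n hn
  rw [Pi.div_apply, mul_pow, mul_div_mul_left _ _ (by positivity)]

lemma eventually_gaussEnergy_pos : ∀ᶠ n in atTop, 0 < gaussEnergy n := by
  have hπ : 0 < √Real.pi := Real.sqrt_pos.2 Real.pi_pos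
  filter_upwards [eventually_gaussScale_pos,
    tendsto_gaussScale_mul_gaussEnergy.eventually_const_lt (show 0 < √Real.pi ^ 3 / 2 by positivity)]
    with n h1 h2
  exact (pos_iff_pos_of_mul_pos h2).1 (by positivity)

/-- The mass is of order `n / log n`, so its logarithm is `log n` up to `log log n + O(1)`. -/
lemma tendsto_log_gaussMass_div_log :
    Tendsto (fun n => Real.log (gaussMass n) / Real.log n) atTop (𝓝 1) := by
  have hπ : 0 < √Real.pi := Real.sqrt_pos.2 Real.pi_pos
  have h1 : Tendsto (fun n => Real.log (gaussScale n * gaussMass n) / Real.log n) atTop (𝓝 0) :=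
    (tendsto_gaussScale_mul_gaussMass.log (by positivity)).div_atTop tendsto_log_natCast
  have h2 : Tendsto (fun n : ℕ => Real.log (Real.log n) / Real.log n) atTop (𝓝 0) :=
    Real.isLittleO_log_id_atTop.tendsto_div_nhds_zero.comp tendsto_log_natCast
  have h3 := (h1.sub h2).add_const 1
  rw [sub_zero, zero_add] at h3
  refine h3.congr' ?_
  filter_upwards [eventually_gaussScale_pos, eventually_ge_atTop 2] with n hn hn2
  have hn1 : (1 : ℝ) < n := by exact_mod_cast hn2
  have hl := Real.log_pos hn1
  have hM : 0 < gaussMass n := by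
    have := halfGaussSum_nonneg (2 / √3 * gaussScale n) n
    rw [gaussMass]; linarith
  rw [Real.log_mul hn.ne' hM.ne', gaussScale, Real.log_div hl.ne' (by linarith)]
  field_simp
  ring

lemma one_lt_young_constant : 1 < 3 * √3 / 4 := by
  have : (4 / 3 : ℝ) < √3 := Real.lt_sqrt_of_sq_lt (by norm_num)
  linarith

lemma eventually_three_sub_mul_log_gaussMass_le : ∀ᶠ n : ℕ in atTop,
    (3 - minEnergyExponent n) * Real.log (gaussMass n) ≤
      Real.log (gaussMass n ^ 3 / gaussEnergy n) := by
  filter_upwards [eventually_gaussEnergy_pos, eventually_ge_atTop 2] with n hE hn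
  refine three_sub_mul_log_le hn (f := fun i => Real.exp
      (-(gaussScale n * ((i : ℝ) - ((n - 1) / 2 : ℕ))) ^ 2)) (fun x => Real.exp_pos _)
    (fun x => Real.exp_le_one_iff.2 (neg_nonpos.2 (sq_nonneg _))) hE ?_ ?_
  · exact le_energyOf_gaussian _ (by omega)
  · exact sum_gaussian_rpow_le _ (by omega)

/-- The relative error in the lower bound for `t_n`. -/
noncomputable def exponentError (n : ℕ) : ℝ :=
  max 0 ((3 - minEnergyExponent n) * Real.log n / Real.log (3 * √3 / 4) - 1)

/-- The error is defined so that the lower bound holds for every `n ≥ 2`. Truncation at 0 leaves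
only an upper estimate to prove, and the Gaussian supplies it for large `n`. -/
lemma tendsto_exponentError : Tendsto exponentError atTop (𝓝 0) := by
  have hK := Real.log_pos one_lt_young_constant
  have h1 : Tendsto (fun n => Real.log (gaussMass n ^ 3 / gaussEnergy n) /
      (Real.log (gaussMass n) / Real.log n) / Real.log (3 * √3 / 4) - 1) atTop (𝓝 0) := by
    have h := ((((tendsto_gaussMass_pow_div_gaussEnergy.log
      (by linarith [one_lt_young_constant])).div tendsto_log_gaussMass_div_log one_ne_zero).div_const
      (Real.log (3 * √3 / 4))).sub_const 1)
    rw [div_one, div_self hK.ne', sub_self] at h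
    exact h
  have h2 := (tendsto_const_nhds (x := (0 : ℝ))).max h1
  rw [max_self] at h2
  refine tendsto_of_tendsto_of_tendsto_of_le_of_le' tendsto_const_nhds h2
    (Eventually.of_forall fun n => le_max_left _ _) ?_
  filter_upwards [eventually_three_sub_mul_log_gaussMass_le, eventually_ge_atTop 2,
    tendsto_log_gaussMass_div_log.eventually_const_lt one_pos] with n hn hn2 hpos
  have hl : 0 < Real.log n := Real.log_pos (by exact_mod_cast hn2)
  refine max_le_max le_rfl (sub_le_sub_right (div_le_div_of_nonneg_right ?_ hK.le) 1)
  rw [le_div_iff₀ hpos]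
  refine le_of_eq_of_le ?_ hn
  field_simp

lemma le_minEnergyExponent {n : ℕ} (hn : 2 ≤ n) :
    3 - (1 + exponentError n) * Real.logb n (3 * √3 / 4) ≤ minEnergyExponent n := by
  have hK := Real.log_pos one_lt_young_constant
  have hl : 0 < Real.log n := Real.log_pos (by exact_mod_cast hn)
  have h := le_max_right 0 ((3 - minEnergyExponent n) * Real.log n / Real.log (3 * √3 / 4) - 1)
  rw [← exponentError] at h
  have h2 : (3 - minEnergyExponent n) * Real.log n / Real.log (3 * √3 / 4) ≤
      1 + exponentError n := by linarith
  rw [div_le_iff₀ hK] at h2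
  have h3 : 3 - minEnergyExponent n ≤ (1 + exponentError n) * Real.logb n (3 * √3 / 4) := by
    rw [Real.logb, ← mul_div_assoc, le_div_iff₀ hl]
    exact h2
  linarith

end LowerBound

theorem theorem1 :
    ∃ c : ℝ, 0 < c ∧ ∃ ε : ℕ → ℝ, Tendsto ε atTop (𝓝 0) ∧
      ∀ n : ℕ, 2 ≤ n →
        IsLeast (energyExponents n) (minEnergyExponent n) ∧
        3 - (1 + ε n) * Real.logb n (3 * √3 / 4) ≤ minEnergyExponent n ∧
        minEnergyExponent n ≤ 3 - Real.logb n (1 + c) :=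
  ⟨energyGap, energyGap_pos, exponentError, tendsto_exponentError, fun _ hn =>
    ⟨isLeast_minEnergyExponent hn, le_minEnergyExponent hn, minEnergyExponent_le hn⟩⟩
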